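/- Let $G$ be a three-dimensional Lie group with a basis $e^1,e^2,e^3$ of left-invariant 1-forms satisfying $de^1=-b_1e^{2}\wedge e^3$, $de^2=-b_2e^{3}\wedge e^1$, $de^3=-b_3e^{1}\wedge e^2$; we say that $(G,e^1,e^2,e^3)$ is of Bianchi type $IX$, $VIII$, $VII_0$, $VI_0$, $II$ if $(b_1,b_2,b_3)=(1,1,1)$, $(1,1,-1)$, $(0,1,1)$, $(0,1,-1)$, $(0,0,1)$ respectively. Let $T\subset\mathbb R$ be an open interval, let $f,f_1,f_2,f_3$ be smooth nowhere vanishing functions on $T$, and put $e^i(t)=f_i(t)e^i$. On $G\times T$ consider the metric $g=(e^1(t))^2+(e^2(t))^2+(e^3(t))^2+f^2dt^2$ with the 2-forms $F_1=e^1(t)\wedge e^2(t)+e^3(t)\wedge f\,dt$, $F_2=e^1(t)\wedge e^3(t)-e^2(t)\wedge f\,dt$, $F_3=e^2(t)\wedge e^3(t)+e^1(t)\wedge f\,dt$. We call this structure (triaxial) hyper-Kähler if there are almost complex structures $J_1,J_2,J_3$ with $J_1J_2=-J_2J_1=J_3$, isometric for $g$, with $F_s=g(J_s\cdot,\cdot)$,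 and parallel for the Levi-Civita connection of $g$. On $G\times T$ consider also the neutral metric $g'=(e^1(t))^2+(e^2(t))^2-(e^3(t))^2-f^2dt^2$ with the 2-forms $\Omega_1=-e^1(t)\wedge e^2(t)+e^3(t)\wedge f\,dt$, $\Omega_2=e^1(t)\wedge e^3(t)-e^2(t)\wedge f\,dt$, $\Omega_3=e^2(t)\wedge e^3(t)+e^1(t)\wedge f\,dt$. We call this structure (triaxial) hyper-symplectic if there are endomorphism fields $J,P_1,P_2$ with $J^2=-1$, $P_1^2=P_2^2=1$, $JP_1=-P_1J=P_2$, with $J$ isometric and $P_1,P_2$ anti-isometric for $g'$, with $\Omega_1=g'(\cdot,J\cdot)$, $\Omega_2=g'(\cdot,P_1\cdot)$, $\Omega_3=g'(\cdot,P_2\cdot)$, and $d\Omega_1=d\Omega_2=d\Omega_3=0$. Attach to the Bianchi types the following systems of ordinary differential equations on $T$: * $IX$: $(f_1f_2)'=ff_3,\ (f_1f_3)'=ff_2,\ (f_2f_3)'=ff_1$; * $VIII$: $(f_1f_2)'=-ff_3,\ (f_1f_3)'=ff_2,\ (f_2f_3)'=ff_1$; * $VII_0$: $(f_1f_2)'=ff_3,\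 (f_1f_3)'=ff_2,\ (f_2f_3)'=0$; * $VI_0$: $(f_1f_2)'=-ff_3,\ (f_1f_3)'=ff_2,\ (f_2f_3)'=0$; * $II$: $(f_1f_2)'=ff_3,\ (f_1f_3)'=0,\ (f_2f_3)'=0$. Then for each $\tau\in\{IX,VIII,VII_0,VI_0,II\}$: 1. If $(G,e^1,e^2,e^3)$ is of type $\tau$, the structure $(g,F_1,F_2,F_3)$ defined by $f,f_1,f_2,f_3$ is hyper-Kähler if and only if the system of type $\tau$ holds. 2. Let $\tau^*=VIII,IX,VI_0,VII_0,II$ for $\tau=IX,VIII,VII_0,VI_0,II$ respectively. If $(G,e^1,e^2,e^3)$ is of type $\tau^*$, the structure $(g',\Omega_1,\Omega_2,\Omega_3)$ defined by $f,f_1,f_2,f_3$ (by $f,f_1,f_2,-f_3$ if $\tau=II$) is hyper-symplectic if and only if the same system, of type $\tau$, holds. 3. The smooth nowhere vanishing solutions $(f,f_1,f_2,f_3)$ on $T$ of the system of type $\tau$ are exactly the following functions, where $\varepsilon_1,\varepsilon_2,\varepsilon_3\in\{1,-1\}$ are signs. For $\tau\neq II$: $$f_1=\varepsilon_1\frac{y_2^{1/4}y_3^{1/4}}{y_1^{1/4}},\quad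 f_2=\varepsilon_2\frac{y_1^{1/4}y_3^{1/4}}{y_2^{1/4}},\quad f_3=\varepsilon_3\frac{y_1^{1/4}y_2^{1/4}}{y_3^{1/4}},\quad f=\varepsilon_1\varepsilon_2\varepsilon_3\,\tfrac12(y_1y_2y_3)^{-1/4}\,x'(t),$$ where $x$ is a smooth function on $T$ with nowhere vanishing derivative, $a_1,a_2,a_3$ are real constants, and $(y_1,y_2,y_3)$ equals $(x-a_1,x-a_2,x-a_3)$ for $IX$, $(x-a_1,x-a_2,a_3-x)$ for $VIII$, $(a_1,x-a_2,x-a_3)$ for $VII_0$, $(a_1,x-a_2,a_3-x)$ for $VI_0$, with all $y_i>0$ on $T$. For $\tau=II$: $$f_1=\varepsilon_1\left(\tfrac ba\right)^{1/4}w^{1/3},\quad f_2=\varepsilon_2\left(\tfrac ab\right)^{1/4}w^{1/3},\quad f_3=\varepsilon_3\frac{(ab)^{1/4}}{w^{1/3}},\quad f=\varepsilon_1\varepsilon_2\varepsilon_3\,r'(t),\qquad w=\tfrac32(ab)^{1/4}r+c,$$ where $a,b>0$ and $c$ are real constants and $r$ is a smooth function on $T$ with nowhere vanishing derivative and $w>0$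 on $T$. -/

import Mathlib

open Set
open scoped Manifold ContDiff

noncomputable section

/-! ### Tensor fields on open subsets of a smooth manifold -/

section Manifold

variable {E : Type*} [NormedAddCommGroup E] [NormedSpace ℝ E]
  {H : Type*} [TopologicalSpace H] (I : ModelWithCorners ℝ E H)
  {M : Type*} [TopologicalSpace M] [ChartedSpace H M]

/-- Vector fields, not assumed to be regular. -/
abbrev VecField : Type _ := (p : M) → TangentSpace I p

/-- 1-forms, not assumed to be regular. -/
abbrev OneForm : Type _ := (p : M) → TangentSpace I p →ₗ[ℝ] ℝ

/-- Fields of bilinear forms on the tangent spaces: metrics and 2-forms. -/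
abbrev BilinField : Type _ := (p : M) → LinearMap.BilinForm ℝ (TangentSpace I p)

/-- Fields of endomorphisms of the tangent spaces. -/
abbrev EndField : Type _ := (p : M) → TangentSpace I p →ₗ[ℝ] TangentSpace I p

variable {I}

/-- The wedge product of two 1-forms, `(α ∧ β)(v, w) = α(v) β(w) - β(v) α(w)`. -/
def wedge (α β : OneForm I (M := M)) : BilinField I (M := M) := fun p =>
  (α p).smulRight (β p) - (β p).smulRight (α p)

/-- The symmetric square `α²` of a 1-form, `α²(v, w) = α(v) α(w)`. -/
def sqForm (α : OneForm I (M := M)) : BilinField I (M := M) := fun p =>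
  (α p).smulRight (α p)

/-- The derivative at `p` of the function `u` in the direction of the vector field `X`. -/
def dirDeriv (X : VecField I (M := M)) (u : M → ℝ) (p : M) : ℝ :=
  mvfderiv I u p (X p)

/-- The exterior derivative of a 1-form, evaluated on vector fields. -/
def extDerivOne (α : OneForm I (M := M)) (X Y : VecField I (M := M)) (p : M) : ℝ :=
  dirDeriv X (fun q => α q (Y q)) p - dirDeriv Y (fun q => α q (X q)) p
    - α p (VectorField.mlieBracket I X Y p)

/-- The exterior derivative of a 2-form, evaluated on vector fields. -/
def extDerivTwo (η : BilinField I (M := M)) (X Y Z : VecField I (M := M)) (p : M) : ℝ :=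
  dirDeriv X (fun q => η q (Y q) (Z q)) p - dirDeriv Y (fun q => η q (X q) (Z q)) p
    + dirDeriv Z (fun q => η q (X q) (Y q)) p
    - η p (VectorField.mlieBracket I X Y p) (Z p)
    + η p (VectorField.mlieBracket I X Z p) (Y p)
    - η p (VectorField.mlieBracket I Y Z p) (X p)

variable [IsManifold I ∞ M]

/-- The vector field `X` is smooth on `U`. -/
def SmoothFieldOn (X : VecField I (M := M)) (U : Set M) : Prop :=
  ContMDiffOn I I.tangent ∞ (fun p => (⟨p, X p⟩ : TangentBundle I M)) U

/-- The field of bilinear forms `g` is smooth on the open set `U`. -/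
def SmoothBilinOn (g : BilinField I (M := M)) (U : Set M) : Prop :=
  ∀ X Y : VecField I (M := M), SmoothFieldOn X U → SmoothFieldOn Y U →
    ContMDiffOn I 𝓘(ℝ, ℝ) ∞ (fun p => g p (X p) (Y p)) U

/-- The field of endomorphisms `J` is smooth on the open set `U`. -/
def SmoothEndOn (J : EndField I (M := M)) (U : Set M) : Prop :=
  ∀ X : VecField I (M := M), SmoothFieldOn X U → SmoothFieldOn (fun p => J p (X p)) U

/-- The 2-form `η` is closed on the open set `U`. -/
def ClosedTwoFormOn (η : BilinField I (M := M)) (U : Set M) : Prop :=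
  ∀ X Y Z : VecField I (M := M), SmoothFieldOn X U → SmoothFieldOn Y U → SmoothFieldOn Z U →
    ∀ p ∈ U, extDerivTwo η X Y Z p = 0

/-- `g` is a smooth pseudo-Riemannian metric on `U`. -/
structure IsPseudoMetricOn (g : BilinField I (M := M)) (U : Set M) : Prop where
  smooth : SmoothBilinOn g U
  symm : ∀ p ∈ U, ∀ v w, g p v w = g p w v
  nondegenerate : ∀ p ∈ U, ∀ v, (∀ w, g p v w = 0) → v = 0

/-- `∇` is the Levi-Civita connection of `g` on the open set `U`: a torsion free covariant
derivative for which `g` is parallel. In Mathlib's notation `∇ Y p v` is `(∇_v Y)(p)`. -/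
structure IsLeviCivitaOn (g : BilinField I (M := M))
    (nabla : VecField I (M := M) → (p : M) → TangentSpace I p →L[ℝ] TangentSpace I p)
    (U : Set M) : Prop where
  cov : IsCovariantDerivativeOn E nabla U
  torsion_free : ∀ X Y : VecField I (M := M), SmoothFieldOn X U → SmoothFieldOn Y U →
    ∀ p ∈ U, nabla Y p (X p) - nabla X p (Y p) = VectorField.mlieBracket I X Y p
  metric : ∀ X Y Z : VecField I (M := M),
    SmoothFieldOn X U → SmoothFieldOn Y U → SmoothFieldOn Z U →
    ∀ p ∈ U, dirDeriv X (fun q => g q (Y q) (Z q)) p =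
      g p (nabla Y p (X p)) (Z p) + g p (Y p) (nabla Z p (X p))

/-- The field of endomorphisms `J` is parallel on `U`: `∇_v (J Y) = J (∇_v Y)`. -/
def ParallelOn
    (nabla : VecField I (M := M) → (p : M) → TangentSpace I p →L[ℝ] TangentSpace I p)
    (J : EndField I (M := M)) (U : Set M) : Prop :=
  ∀ Y : VecField I (M := M), SmoothFieldOn Y U → ∀ p ∈ U, ∀ v : TangentSpace I p,
    nabla (fun q => J q (Y q)) p v = J p (nabla Y p v)

/-- `(g, J₁, J₂, J₃)` is an almost hyper-Hermitian structure on `U`. -/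
structure IsAlmostHyperHermitianOn (g : BilinField I (M := M))
    (J₁ J₂ J₃ : EndField I (M := M)) (U : Set M) : Prop where
  metric : IsPseudoMetricOn g U
  pos : ∀ p ∈ U, ∀ v, v ≠ 0 → 0 < g p v v
  smooth₁ : SmoothEndOn J₁ U
  smooth₂ : SmoothEndOn J₂ U
  smooth₃ : SmoothEndOn J₃ U
  sq₁ : ∀ p ∈ U, ∀ v, J₁ p (J₁ p v) = -v
  sq₂ : ∀ p ∈ U, ∀ v, J₂ p (J₂ p v) = -v
  sq₃ : ∀ p ∈ U, ∀ v, J₃ p (J₃ p v) = -v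
  mul₁₂ : ∀ p ∈ U, ∀ v, J₁ p (J₂ p v) = J₃ p v
  mul₂₁ : ∀ p ∈ U, ∀ v, J₂ p (J₁ p v) = -J₃ p v
  isometry₁ : ∀ p ∈ U, ∀ v w, g p (J₁ p v) (J₁ p w) = g p v w
  isometry₂ : ∀ p ∈ U, ∀ v w, g p (J₂ p v) (J₂ p w) = g p v w
  isometry₃ : ∀ p ∈ U, ∀ v w, g p (J₃ p v) (J₃ p w) = g p v w

/-- The metric `g` and the 2-forms `F₁, F₂, F₃` define a hyper-Kähler structure on `U`: they come
from an almost hyper-Hermitian structure `(g, J₁, J₂, J₃)` with `F_s = g(J_s ·, ·)`, and the `J_s`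
are parallel with respect to the Levi-Civita connection of `g`. -/
def IsHyperKahlerOn (g F₁ F₂ F₃ : BilinField I (M := M)) (U : Set M) : Prop :=
  ∃ J₁ J₂ J₃ : EndField I (M := M), IsAlmostHyperHermitianOn g J₁ J₂ J₃ U ∧
    (∀ p ∈ U, ∀ v w, F₁ p v w = g p (J₁ p v) w) ∧
    (∀ p ∈ U, ∀ v w, F₂ p v w = g p (J₂ p v) w) ∧
    (∀ p ∈ U, ∀ v w, F₃ p v w = g p (J₃ p v) w) ∧
    ∃ nabla, IsLeviCivitaOn g nabla U ∧
      ParallelOn nabla J₁ U ∧ ParallelOn nabla J₂ U ∧ ParallelOn nabla J₃ U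

/-- `(g, J, P₁, P₂)` is an almost hyper-parahermitian structure on `U`. -/
structure IsAlmostHyperParahermitianOn (g : BilinField I (M := M))
    (J P₁ P₂ : EndField I (M := M)) (U : Set M) : Prop where
  metric : IsPseudoMetricOn g U
  smoothJ : SmoothEndOn J U
  smooth₁ : SmoothEndOn P₁ U
  smooth₂ : SmoothEndOn P₂ U
  sqJ : ∀ p ∈ U, ∀ v, J p (J p v) = -v
  sq₁ : ∀ p ∈ U, ∀ v, P₁ p (P₁ p v) = v
  sq₂ : ∀ p ∈ U, ∀ v, P₂ p (P₂ p v) = v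
  mulJ₁ : ∀ p ∈ U, ∀ v, J p (P₁ p v) = P₂ p v
  mul₁J : ∀ p ∈ U, ∀ v, P₁ p (J p v) = -P₂ p v
  isometryJ : ∀ p ∈ U, ∀ v w, g p (J p v) (J p w) = g p v w
  antiisometry₁ : ∀ p ∈ U, ∀ v w, g p (P₁ p v) (P₁ p w) = -g p v w
  antiisometry₂ : ∀ p ∈ U, ∀ v w, g p (P₂ p v) (P₂ p w) = -g p v w

/-- The metric `g` and the 2-forms `Ω₁, Ω₂, Ω₃` define a hyper-symplectic structure on `U`: they
come from an almost hyper-parahermitian structure `(g, J, P₁, P₂)` with `Ω₁ = g(·, J ·)`,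
`Ω₂ = g(·, P₁ ·)`, `Ω₃ = g(·, P₂ ·)`, and these three forms are closed. -/
def IsHyperSymplecticOn (g Ω₁ Ω₂ Ω₃ : BilinField I (M := M)) (U : Set M) : Prop :=
  ∃ J P₁ P₂ : EndField I (M := M), IsAlmostHyperParahermitianOn g J P₁ P₂ U ∧
    (∀ p ∈ U, ∀ v w, Ω₁ p v w = g p v (J p w)) ∧
    (∀ p ∈ U, ∀ v w, Ω₂ p v w = g p v (P₁ p w)) ∧
    (∀ p ∈ U, ∀ v w, Ω₃ p v w = g p v (P₂ p w)) ∧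
    ClosedTwoFormOn Ω₁ U ∧ ClosedTwoFormOn Ω₂ U ∧ ClosedTwoFormOn Ω₃ U

end Manifold

/-! ### Bianchi types and left-invariant coframes -/

/-- The non-abelian unimodular (class A) Bianchi types. -/
inductive BianchiType : Type
  | IX
  | VIII
  | VII0
  | VI0
  | II

namespace BianchiType

/-- The constants `b₁, b₂, b₃` of the structure equations
`de¹ = -b₁ e²³`, `de² = -b₂ e³¹`, `de³ = -b₃ e¹²`. -/
def structureConst : BianchiType → Fin 3 → ℝ
  | IX => ![1, 1, 1]
  | VIII => ![1, 1, -1]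
  | VII0 => ![0, 1, 1]
  | VI0 => ![0, 1, -1]
  | II => ![0, 0, 1]

/-- The matching IX ↔ VIII, VII₀ ↔ VI₀, II ↔ II. -/
def matching : BianchiType → BianchiType
  | IX => VIII
  | VIII => IX
  | VII0 => VI0
  | VI0 => VII0
  | II => II

/-- In type II the function `f₃` has to be replaced by `-f₃` on the hyper-symplectic side. -/
def matchingSign : BianchiType → ℝ
  | IX => 1
  | VIII => 1
  | VII0 => 1
  | VI0 => 1
  | II => -1

end BianchiType

section Group

variable {G : Type*} [TopologicalSpace G] [ChartedSpace (EuclideanSpace ℝ (Fin 3)) G] [Group G]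

/-- `α` is invariant under pull-back by the left translations of `G`. -/
def IsLeftInvariantForm (α : OneForm (𝓡 3) (M := G)) : Prop :=
  ∀ (a g : G) (v : TangentSpace (𝓡 3) g),
    α (a * g) (mfderiv (𝓡 3) (𝓡 3) (fun h => a * h) g v) = α g v

/-- The 1-form `u(t) α` on `G × ℝ`, for a 1-form `α` on `G` and a function `u` of `t ∈ ℝ`. -/
def evolvedForm (u : ℝ → ℝ) (α : OneForm (𝓡 3) (M := G)) :
    OneForm ((𝓡 3).prod 𝓘(ℝ, ℝ)) (M := G × ℝ) := fun p =>
  u p.2 • (α p.1 ∘ₗ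
    (mfderiv ((𝓡 3).prod 𝓘(ℝ, ℝ)) (𝓡 3) (Prod.fst : G × ℝ → G) p).toLinearMap)

variable (G) in
/-- The 1-form `u(t) dt` on `G × ℝ`. -/
def timeForm (u : ℝ → ℝ) : OneForm ((𝓡 3).prod 𝓘(ℝ, ℝ)) (M := G × ℝ) := fun p =>
  u p.2 • (mvfderiv ((𝓡 3).prod 𝓘(ℝ, ℝ)) (Prod.snd : G × ℝ → ℝ) p).toLinearMap

variable [LieGroup (𝓡 3) ∞ G]

/-- `e¹, e², e³` (indexed by `0, 1, 2`) is a basis of the left-invariant 1-forms on the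
three-dimensional Lie group `G`, satisfying the structure equations of Bianchi type `τ`. -/
structure IsBianchiCoframe (τ : BianchiType) (e : Fin 3 → OneForm (𝓡 3) (M := G)) : Prop where
  left_invariant : ∀ i, IsLeftInvariantForm (e i)
  independent : ∀ g, LinearIndependent ℝ (fun i => e i g)
  structure_eq₁ : ∀ X Y : VecField (𝓡 3) (M := G), SmoothFieldOn X univ → SmoothFieldOn Y univ →
    ∀ g, extDerivOne (e 0) X Y g = -(τ.structureConst 0) * wedge (e 1) (e 2) g (X g) (Y g)
  structure_eq₂ : ∀ X Y : VecField (𝓡 3) (M := G), SmoothFieldOn X univ → SmoothFieldOn Y univ →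
    ∀ g, extDerivOne (e 1) X Y g = -(τ.structureConst 1) * wedge (e 2) (e 0) g (X g) (Y g)
  structure_eq₃ : ∀ X Y : VecField (𝓡 3) (M := G), SmoothFieldOn X univ → SmoothFieldOn Y univ →
    ∀ g, extDerivOne (e 2) X Y g = -(τ.structureConst 2) * wedge (e 0) (e 1) g (X g) (Y g)

/-- The diagonal evolution `eⁱ(t) = fᵢ(t) eⁱ` and `f` define a triaxial hyper-Kähler structure on
`G × T`, with metric `(e¹(t))² + (e²(t))² + (e³(t))² + f² dt²` and fundamental 2-forms
`F₁ = e¹(t) ∧ e²(t) + e³(t) ∧ f dt`, `F₂ = e¹(t) ∧ e³(t) - e²(t) ∧ f dt`,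
`F₃ = e²(t) ∧ e³(t) + e¹(t) ∧ f dt`. -/
def IsTriaxialHyperKahler (e : Fin 3 → OneForm (𝓡 3) (M := G)) (T : Set ℝ)
    (f f₁ f₂ f₃ : ℝ → ℝ) : Prop :=
  let e₁ := evolvedForm f₁ (e 0)
  let e₂ := evolvedForm f₂ (e 1)
  let e₃ := evolvedForm f₃ (e 2)
  let fdt := timeForm G f
  IsHyperKahlerOn (sqForm e₁ + sqForm e₂ + sqForm e₃ + sqForm fdt)
    (wedge e₁ e₂ + wedge e₃ fdt) (wedge e₁ e₃ - wedge e₂ fdt) (wedge e₂ e₃ + wedge e₁ fdt)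
    (univ ×ˢ T)

/-- The diagonal evolution `eⁱ(t) = fᵢ(t) eⁱ` and `f` define a triaxial hyper-symplectic structure
on `G × T`, with metric `(e¹(t))² + (e²(t))² - (e³(t))² - f² dt²` and fundamental 2-forms
`Ω₁ = -e¹(t) ∧ e²(t) + e³(t) ∧ f dt`, `Ω₂ = e¹(t) ∧ e³(t) - e²(t) ∧ f dt`,
`Ω₃ = e²(t) ∧ e³(t) + e¹(t) ∧ f dt`. -/
def IsTriaxialHyperSymplectic (e : Fin 3 → OneForm (𝓡 3) (M := G)) (T : Set ℝ)
    (f f₁ f₂ f₃ : ℝ → ℝ) : Prop :=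
  let e₁ := evolvedForm f₁ (e 0)
  let e₂ := evolvedForm f₂ (e 1)
  let e₃ := evolvedForm f₃ (e 2)
  let fdt := timeForm G f
  IsHyperSymplecticOn (sqForm e₁ + sqForm e₂ - sqForm e₃ - sqForm fdt)
    (-wedge e₁ e₂ + wedge e₃ fdt) (wedge e₁ e₃ - wedge e₂ fdt) (wedge e₂ e₃ + wedge e₁ fdt)
    (univ ×ˢ T)

end Group

/-! ### The systems of ordinary differential equations and their general solutions -/

/-- `f, f₁, f₂, f₃` are smooth and vanish nowhere on `T`. -/
structure IsEvolutionData (T : Set ℝ) (f f₁ f₂ f₃ : ℝ → ℝ) : Prop where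
  smooth : ContDiffOn ℝ ∞ f T
  smooth₁ : ContDiffOn ℝ ∞ f₁ T
  smooth₂ : ContDiffOn ℝ ∞ f₂ T
  smooth₃ : ContDiffOn ℝ ∞ f₃ T
  ne_zero : ∀ t ∈ T, f t ≠ 0
  ne_zero₁ : ∀ t ∈ T, f₁ t ≠ 0
  ne_zero₂ : ∀ t ∈ T, f₂ t ≠ 0
  ne_zero₃ : ∀ t ∈ T, f₃ t ≠ 0

/-- `(f₁ f₂)' = c₁₂`, `(f₁ f₃)' = c₁₃`, `(f₂ f₃)' = c₂₃` on `T`. -/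
def ProductDerivs (T : Set ℝ) (f₁ f₂ f₃ c₁₂ c₁₃ c₂₃ : ℝ → ℝ) : Prop :=
  ∀ t ∈ T, HasDerivAt (fun s => f₁ s * f₂ s) (c₁₂ t) t ∧
    HasDerivAt (fun s => f₁ s * f₃ s) (c₁₃ t) t ∧
    HasDerivAt (fun s => f₂ s * f₃ s) (c₂₃ t) t

/-- The system of ordinary differential equations attached to each Bianchi type. -/
def EvolutionSystem (τ : BianchiType) (T : Set ℝ) (f f₁ f₂ f₃ : ℝ → ℝ) : Prop :=
  match τ with
  | .IX => ProductDerivs T f₁ f₂ f₃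
      (fun t => f t * f₃ t) (fun t => f t * f₂ t) (fun t => f t * f₁ t)
  | .VIII => ProductDerivs T f₁ f₂ f₃
      (fun t => -(f t * f₃ t)) (fun t => f t * f₂ t) (fun t => f t * f₁ t)
  | .VII0 => ProductDerivs T f₁ f₂ f₃
      (fun t => f t * f₃ t) (fun t => f t * f₂ t) (fun _ => 0)
  | .VI0 => ProductDerivs T f₁ f₂ f₃
      (fun t => -(f t * f₃ t)) (fun t => f t * f₂ t) (fun _ => 0)
  | .II => ProductDerivs T f₁ f₂ f₃
      (fun t => f t * f₃ t) (fun _ => 0) (fun _ => 0)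

/-- With `y₁, y₂, y₃` positive on `T` and `x` a smooth function of `t` with nowhere vanishing
derivative, `fᵢ = εᵢ yⱼ^{1/4} y_k^{1/4} / yᵢ^{1/4}` and
`f = ε₁ε₂ε₃ h x'` with `h = (1/2) (y₁ y₂ y₃)^{-1/4}`. -/
def QuarticForm (T : Set ℝ) (ε₁ ε₂ ε₃ : ℝ) (x y₁ y₂ y₃ f f₁ f₂ f₃ : ℝ → ℝ) : Prop :=
  ContDiffOn ℝ ∞ x T ∧ ∀ t ∈ T, deriv x t ≠ 0 ∧ 0 < y₁ t ∧ 0 < y₂ t ∧ 0 < y₃ t ∧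
    f₁ t = ε₁ * (y₂ t ^ (1 / 4 : ℝ) * y₃ t ^ (1 / 4 : ℝ) / y₁ t ^ (1 / 4 : ℝ)) ∧
    f₂ t = ε₂ * (y₁ t ^ (1 / 4 : ℝ) * y₃ t ^ (1 / 4 : ℝ) / y₂ t ^ (1 / 4 : ℝ)) ∧
    f₃ t = ε₃ * (y₁ t ^ (1 / 4 : ℝ) * y₂ t ^ (1 / 4 : ℝ) / y₃ t ^ (1 / 4 : ℝ)) ∧
    f t = ε₁ * ε₂ * ε₃ * (1 / 2 * (y₁ t * y₂ t * y₃ t) ^ (-(1 / 4) : ℝ) * deriv x t)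

/-- The explicit functions, with the signs `ε₁, ε₂, ε₃` of `f₁, f₂, f₃`. -/
def ExplicitForm (τ : BianchiType) (T : Set ℝ) (ε₁ ε₂ ε₃ : ℝ) (f f₁ f₂ f₃ : ℝ → ℝ) : Prop :=
  match τ with
  | .IX => ∃ (a₁ a₂ a₃ : ℝ) (x : ℝ → ℝ), QuarticForm T ε₁ ε₂ ε₃ x
      (fun t => x t - a₁) (fun t => x t - a₂) (fun t => x t - a₃) f f₁ f₂ f₃
  | .VIII => ∃ (a₁ a₂ a₃ : ℝ) (x : ℝ → ℝ), QuarticForm T ε₁ ε₂ ε₃ x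
      (fun t => x t - a₁) (fun t => x t - a₂) (fun t => a₃ - x t) f f₁ f₂ f₃
  | .VII0 => ∃ (a₁ a₂ a₃ : ℝ) (x : ℝ → ℝ), QuarticForm T ε₁ ε₂ ε₃ x
      (fun _ => a₁) (fun t => x t - a₂) (fun t => x t - a₃) f f₁ f₂ f₃
  | .VI0 => ∃ (a₁ a₂ a₃ : ℝ) (x : ℝ → ℝ), QuarticForm T ε₁ ε₂ ε₃ x
      (fun _ => a₁) (fun t => x t - a₂) (fun t => a₃ - x t) f f₁ f₂ f₃
  | .II => ∃ (a b c : ℝ) (r : ℝ → ℝ), 0 < a ∧ 0 < b ∧ ContDiffOn ℝ ∞ r T ∧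
      ∀ t ∈ T, deriv r t ≠ 0 ∧ 0 < 3 / 2 * (a * b) ^ (1 / 4 : ℝ) * r t + c ∧
        f₁ t = ε₁ * ((b / a) ^ (1 / 4 : ℝ) *
          (3 / 2 * (a * b) ^ (1 / 4 : ℝ) * r t + c) ^ (1 / 3 : ℝ)) ∧
        f₂ t = ε₂ * ((a / b) ^ (1 / 4 : ℝ) *
          (3 / 2 * (a * b) ^ (1 / 4 : ℝ) * r t + c) ^ (1 / 3 : ℝ)) ∧
        f₃ t = ε₃ * ((a * b) ^ (1 / 4 : ℝ) /
          (3 / 2 * (a * b) ^ (1 / 4 : ℝ) * r t + c) ^ (1 / 3 : ℝ)) ∧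
        f t = ε₁ * ε₂ * ε₃ * deriv r t

end

universe u

/-!
The proof rests on a description of both structures by a coframe `η¹, …, η⁴` with structure
equations of diagonal shape, `dηⁱ = Aᵢ η⁴ ∧ ηⁱ - Bᵢ ηʲ ∧ ηᵏ` for `(i, j, k)` cyclic and `dη⁴ = 0`
(`IsDiagonalCoframeOn`). The coframe `f₁ e¹, f₂ e², f₃ e³, f dt` of a Bianchi coframe is of this
kind, with `Aᵢ = fᵢ' / (f fᵢ)` and `Bᵢ = bᵢ fᵢ / (fⱼ f_k)`
(`IsBianchiCoframe.exists_isDiagonalCoframeOn`). This uses that left-invariant forms are smooth, by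
means of the Maurer-Cartan map, that the exterior derivative of a smooth 1-form is tensorial, and
that it commutes with the pull-back along `G × ℝ → G`, because brackets of related vector fields
are related.

In such a coframe each of the fundamental 2-forms has an exterior derivative which is a multiple
of one product `ηⁱ ∧ ηʲ ∧ η⁴`, so that closedness of the three forms amounts to `Aᵢ + Aⱼ = ±B_k`.
The algebraic conditions on the almost complex and almost product structures are met by constant
matrices in the frame, which settles the hyper-symplectic case. In the hyper-Kähler case parallel
complex structures give closed forms, because the exterior derivative can be computed with a
torsion free connection. Conversely, if `Aᵢ + Aⱼ = B_k`, then the connection with `Γⁱ₄ = Aᵢ ηⁱ` and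
`Γⁱⱼ = -A_k ηᵏ` is metric and torsion free, and its connection matrix takes values in the copy of
`𝔰𝔲(2)` in `𝔰𝔬(4)` that commutes with `J₁, J₂, J₃`. In terms of the functions, `Aᵢ + Aⱼ = ±B_k`
reads `(fᵢ fⱼ)' = ±b_k f f_k`. The two kinds of structures differ by the sign of `b₃`, and this sign
change is the matching of the Bianchi types.

For the solutions of the system, the functions `y_k = (fᵢ fⱼ)²` satisfy `y_k' = 2 b_k f f₁ f₂ f₃`.
They are therefore affine functions `b_k x + c_k` of a single function `x`, with
`x' = 2 f f₁ f₂ f₃`, and they determine the `fᵢ` up to sign, the signs being constant on the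
interval. In type II, where `y₁` and `y₂` are constant, the stated form of the solutions follows by
the substitution `w = y₃^{3/4}`.
-/

noncomputable section

open Filter Topology VectorField

/-! ### Lie brackets as derivations of functions -/

section Bracket

variable {E : Type*} [NormedAddCommGroup E] [NormedSpace ℝ E] [CompleteSpace E]
  {H : Type*} [TopologicalSpace H] {I : ModelWithCorners ℝ E H} [I.Boundaryless]
  {M : Type*} [TopologicalSpace M] [ChartedSpace H M] [IsManifold I ∞ M]
  {E' : Type*} [NormedAddCommGroup E'] [NormedSpace ℝ E'] [CompleteSpace E']
  {H' : Type*} [TopologicalSpace H'] {I' : ModelWithCorners ℝ E' H'} [I'.Boundaryless]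
  {M' : Type*} [TopologicalSpace M'] [ChartedSpace H' M'] [IsManifold I' ∞ M']
  {F : Type*} [NormedAddCommGroup F] [NormedSpace ℝ F]

omit [CompleteSpace E] in
theorem contDiffAt_comp_extChartAt_symm {u : M → F} {p q : M} (hq : q ∈ (extChartAt I p).source)
    (hu : ContMDiffAt I 𝓘(ℝ, F) 2 u q) :
    ContDiffAt ℝ 2 (u ∘ (extChartAt I p).symm) (extChartAt I p q) := by
  rw [← contMDiffAt_iff_contDiffAt]
  have h := contMDiffWithinAt_extChartAt_symm_range (I := I) (n := 2) p
    ((extChartAt I p).map_source hq)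
  rw [I.range_eq_univ, contMDiffWithinAt_univ] at h
  refine ContMDiffAt.comp _ ?_ h
  rwa [(extChartAt I p).left_inv hq]

omit [CompleteSpace E] [I.Boundaryless] in
theorem mfderiv_extChartAt_mpullback {p q : M} (hq : q ∈ (extChartAt I p).source)
    (L : VecField 𝓘(ℝ, E) (M := E)) :
    mfderiv I 𝓘(ℝ, E) (extChartAt I p) q (mpullback I 𝓘(ℝ, E) (extChartAt I p) L q) =
      L (extChartAt I p q) := by
  rw [mpullback_apply]
  obtain ⟨e, he⟩ := isInvertible_mfderiv_extChartAt (I := I) hq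
  rw [← he, ContinuousLinearMap.inverse_equiv]
  exact e.apply_symm_apply _

omit [CompleteSpace E] [I.Boundaryless] in
/-- Near `p`, the chart at `p` takes the vector field `Y` to its coordinate representation. -/
theorem eventually_mfderiv_extChartAt (p : M) (Y : VecField I (M := M)) :
    ∀ᶠ q in 𝓝 p, mfderiv I 𝓘(ℝ, E) (extChartAt I p) q (Y q) =
      mpullbackWithin 𝓘(ℝ, E) I (extChartAt I p).symm Y (range I) (extChartAt I p q) := by
  have h1 := eventuallyEq_mpullback_mpullbackWithin_extChartAt (I := I) (s := univ) (x := p) Y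
  rw [nhdsWithin_univ] at h1
  filter_upwards [h1, extChartAt_source_mem_nhds (I := I) p] with q hq hs
  rw [hq]
  exact mfderiv_extChartAt_mpullback hs _

omit [CompleteSpace E] in
theorem mvfderiv_eq_fderiv_comp {u : M → F} {p q : M} (hs : q ∈ (extChartAt I p).source)
    (hu : ContMDiffAt I 𝓘(ℝ, F) 2 u q) (v : TangentSpace I q) :
    mvfderiv I u q v = fderiv ℝ (u ∘ (extChartAt I p).symm) (extChartAt I p q)
      (mfderiv I 𝓘(ℝ, E) (extChartAt I p) q v) := by
  have h4 : u =ᶠ[𝓝 q] (u ∘ (extChartAt I p).symm) ∘ extChartAt I p := by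
    filter_upwards [extChartAt_source_mem_nhds' (I := I) hs] with r hr
    rw [Function.comp_apply, Function.comp_apply, (extChartAt I p).left_inv hr]
  have h5 := (contDiffAt_comp_extChartAt_symm hs hu).differentiableAt (by simp)
  have h6 : mfderiv I 𝓘(ℝ, F) u q = (fderiv ℝ (u ∘ (extChartAt I p).symm) (extChartAt I p q)).comp
      (mfderiv I 𝓘(ℝ, E) (extChartAt I p) q) := by
    rw [h4.mfderiv_eq, mfderiv_comp (I' := 𝓘(ℝ, E)) q h5.mdifferentiableAt
      (mdifferentiableAt_extChartAt (by simpa using hs)), mfderiv_eq_fderiv]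
    rfl
  simp only [mvfderiv, h6]
  rfl

omit [CompleteSpace E] in
/-- The derivative of a function along a vector field, in the coordinates of the chart at `p`. -/
theorem eventually_mvfderiv_eq_fderiv {u : M → F} {p : M} (hu : ContMDiffAt I 𝓘(ℝ, F) 2 u p)
    (Y : VecField I (M := M)) :
    (fun q => mvfderiv I u q (Y q)) =ᶠ[𝓝 p] fun q =>
      fderiv ℝ (u ∘ (extChartAt I p).symm) (extChartAt I p q)
        (mpullbackWithin 𝓘(ℝ, E) I (extChartAt I p).symm Y (range I) (extChartAt I p q)) := by
  have : IsManifold I 2 M := IsManifold.of_le (n := ∞) (by norm_cast)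
  have h2 : ∀ᶠ q in 𝓝 p, ContMDiffAt I 𝓘(ℝ, F) 2 u q :=
    (contMDiffAt_iff_contMDiffAt_nhds (by simp)).1 hu
  filter_upwards [eventually_mfderiv_extChartAt p Y, h2,
    extChartAt_source_mem_nhds (I := I) p] with q hq hu hs
  rw [← hq, mvfderiv_eq_fderiv_comp hs hu]

theorem differentiableAt_mpullbackWithin_extChartAt {p : M} {Y : VecField I (M := M)}
    (hY : MDifferentiableAt I I.tangent (fun q => (⟨q, Y q⟩ : TangentBundle I M)) p) :
    DifferentiableAt ℝ (mpullbackWithin 𝓘(ℝ, E) I (extChartAt I p).symm Y (range I))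
      (extChartAt I p p) := by
  have : IsManifold I 2 M := IsManifold.of_le (n := ∞) (by norm_cast)
  have := (mdifferentiableWithinAt_univ.2 hY).differentiableWithinAt_mpullbackWithin_vectorField
  rw [preimage_univ, univ_inter] at this
  exact this.differentiableAt (by rw [I.range_eq_univ]; exact univ_mem)

theorem mdifferentiableAt_mvfderiv_apply {u : M → F} {p : M} (hu : ContMDiffAt I 𝓘(ℝ, F) 2 u p)
    {Y : VecField I (M := M)}
    (hY : MDifferentiableAt I I.tangent (fun q => (⟨q, Y q⟩ : TangentBundle I M)) p) :
    MDifferentiableAt I 𝓘(ℝ, F) (fun q => mvfderiv I u q (Y q)) p := by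
  have hd := differentiableAt_mpullbackWithin_extChartAt hY
  have hf := (contDiffAt_comp_extChartAt_symm (mem_extChartAt_source p) hu).fderiv_right
    (m := 1) (by norm_num) |>.differentiableAt (by simp)
  exact ((hf.clm_apply hd).mdifferentiableAt.comp p
    (mdifferentiableAt_extChartAt (by simp))).congr_of_eventuallyEq
    (eventually_mvfderiv_eq_fderiv hu Y)

/-- An iterated derivative along two vector fields, in the coordinates of the chart at `p`. -/
theorem mvfderiv_mvfderiv_apply {u : M → F} {p : M} (hu : ContMDiffAt I 𝓘(ℝ, F) 2 u p)
    {Y : VecField I (M := M)}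
    (hY : MDifferentiableAt I I.tangent (fun q => (⟨q, Y q⟩ : TangentBundle I M)) p)
    (X : VecField I (M := M)) :
    mvfderiv I (fun q => mvfderiv I u q (Y q)) p (X p) =
      fderiv ℝ (fun y => fderiv ℝ (u ∘ (extChartAt I p).symm) y
        (mpullbackWithin 𝓘(ℝ, E) I (extChartAt I p).symm Y (range I) y)) (extChartAt I p p)
        (mfderiv I 𝓘(ℝ, E) (extChartAt I p) p (X p)) := by
  have hd := differentiableAt_mpullbackWithin_extChartAt hY
  have hf := (contDiffAt_comp_extChartAt_symm (mem_extChartAt_source p) hu).fderiv_right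
    (m := 1) (by norm_num) |>.differentiableAt (by simp)
  have h := (eventually_mvfderiv_eq_fderiv hu Y).mfderiv_eq (I := I) (I' := 𝓘(ℝ, F))
  have h2 := mfderiv_comp (I := I) (I' := 𝓘(ℝ, E)) (I'' := 𝓘(ℝ, F)) p
    (hf.clm_apply hd).mdifferentiableAt (mdifferentiableAt_extChartAt (I := I) (x := p) (by simp))
  simp only [mvfderiv] at h ⊢
  rw [h]
  rw [mfderiv_eq_fderiv] at h2
  exact congrArg (fun L => L (X p)) h2

/-- The Lie bracket acts on functions as the commutator of the two directional derivatives. -/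
theorem mvfderiv_mlieBracket {u : M → F} {p : M} (hu : ContMDiffAt I 𝓘(ℝ, F) 2 u p)
    {X Y : VecField I (M := M)}
    (hX : MDifferentiableAt I I.tangent (fun q => (⟨q, X q⟩ : TangentBundle I M)) p)
    (hY : MDifferentiableAt I I.tangent (fun q => (⟨q, Y q⟩ : TangentBundle I M)) p) :
    mvfderiv I u p (mlieBracket I X Y p) =
      mvfderiv I (fun q => mvfderiv I u q (Y q)) p (X p) -
        mvfderiv I (fun q => mvfderiv I u q (X q)) p (Y p) := by
  rw [mvfderiv_mvfderiv_apply hu hY, mvfderiv_mvfderiv_apply hu hX]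
  rw [(eventually_mfderiv_extChartAt p X).self_of_nhds,
    (eventually_mfderiv_extChartAt p Y).self_of_nhds]
  have h7 := VectorField.fderiv_apply_lieBracket (𝕜 := ℝ) (n := 2)
    (contDiffAt_comp_extChartAt_symm (mem_extChartAt_source p) hu) (by simp)
    (differentiableAt_mpullbackWithin_extChartAt hY)
    (differentiableAt_mpullbackWithin_extChartAt hX)
  rw [← h7]
  set L := lieBracket ℝ (mpullbackWithin 𝓘(ℝ, E) I (extChartAt I p).symm X (range I))
    (mpullbackWithin 𝓘(ℝ, E) I (extChartAt I p).symm Y (range I)) with hL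
  have h8 : mlieBracket I X Y p = mpullback I 𝓘(ℝ, E) (extChartAt I p) L p := by
    rw [hL, ← mlieBracketWithin_univ, mlieBracketWithin]
    rw [preimage_univ, univ_inter]
    congr 1
    rw [I.range_eq_univ]
    exact lieBracketWithin_univ
  rw [h8, mvfderiv_eq_fderiv_comp (mem_extChartAt_source p) hu]
  exact congrArg _ (mfderiv_extChartAt_mpullback (mem_extChartAt_source p) L)

omit [CompleteSpace E] [I.Boundaryless] [CompleteSpace E'] [I'.Boundaryless]
  [IsManifold I ∞ M] [IsManifold I' ∞ M'] in
theorem mvfderiv_comp_vector {g : M' → F} {f : M → M'} {p : M}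
    (hg : MDifferentiableAt I' 𝓘(ℝ, F) g (f p)) (hf : MDifferentiableAt I I' f p)
    (v : TangentSpace I p) :
    mvfderiv I (fun q => g (f q)) p v = mvfderiv I' g (f p) (mfderiv I I' f p v) :=
  congrArg (fun L => L v) (mfderiv_comp (I'' := 𝓘(ℝ, F)) p hg hf)

/-- Lie brackets of related vector fields are related. -/
theorem mfderiv_mlieBracket_of_related {f : M → M'} {p : M} (hf : ContMDiff I I' ∞ f)
    {X Y : VecField I (M := M)} {X' Y' : VecField I' (M := M')}
    (hX : MDifferentiableAt I I.tangent (fun q => (⟨q, X q⟩ : TangentBundle I M)) p)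
    (hY : MDifferentiableAt I I.tangent (fun q => (⟨q, Y q⟩ : TangentBundle I M)) p)
    (hX' : MDifferentiableAt I' I'.tangent (fun q => (⟨q, X' q⟩ : TangentBundle I' M')) (f p))
    (hY' : MDifferentiableAt I' I'.tangent (fun q => (⟨q, Y' q⟩ : TangentBundle I' M')) (f p))
    (hXX' : ∀ q, mfderiv I I' f q (X q) = X' (f q))
    (hYY' : ∀ q, mfderiv I I' f q (Y q) = Y' (f q)) :
    mfderiv I I' f p (mlieBracket I X Y p) = mlieBracket I' X' Y' (f p) := by
  have hfd : MDifferentiable I I' f := hf.mdifferentiable (by simp)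
  let φ : M' → E' := fun q => extChartAt I' (f p) q
  have hφ : ContMDiffAt I' 𝓘(ℝ, E') 2 φ (f p) := (contMDiffAt_extChartAt (n := ∞)).of_le
    (by norm_cast)
  have hφf : ContMDiffAt I 𝓘(ℝ, E') 2 (fun q => φ (f q)) p :=
    hφ.comp p ((hf p).of_le (by norm_cast))
  -- The chart at `f p` is a vector-valued function with injective differential, so it is enough
  -- to compare the derivatives of this function in the two directions.
  have hinj : Function.Injective (mvfderiv I' φ (f p)) := by
    obtain ⟨e, he⟩ := isInvertible_mfderiv_extChartAt (I := I')
      (mem_extChartAt_source (I := I') (f p))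
    have : (mfderiv I' 𝓘(ℝ, E') φ (f p)) = e := he.symm
    simp only [mvfderiv, this]
    exact e.injective
  have hev : ∀ {Z : VecField I (M := M)} {Z' : VecField I' (M := M')},
      (∀ q, mfderiv I I' f q (Z q) = Z' (f q)) →
      (fun q => mvfderiv I (fun q => φ (f q)) q (Z q)) =ᶠ[𝓝 p]
        fun q => mvfderiv I' φ (f q) (Z' (f q)) := by
    intro Z Z' hZ
    filter_upwards [(hf p).continuousAt.preimage_mem_nhds
      (extChartAt_source_mem_nhds (I := I') (f p))] with q hq
    rw [mvfderiv_comp_vector (mdifferentiableAt_extChartAt (by simpa using hq)) (hfd q), hZ]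
  have hder : ∀ {Z : VecField I (M := M)} {Z' : VecField I' (M := M')},
      MDifferentiableAt I' I'.tangent (fun q => (⟨q, Z' q⟩ : TangentBundle I' M')) (f p) →
      (∀ q, mfderiv I I' f q (Z q) = Z' (f q)) → ∀ v : TangentSpace I p,
      mvfderiv I (fun q => mvfderiv I (fun q => φ (f q)) q (Z q)) p v =
        mvfderiv I' (fun q => mvfderiv I' φ q (Z' q)) (f p) (mfderiv I I' f p v) := by
    intro Z Z' hZd hZ v
    rw [← mvfderiv_comp_vector (mdifferentiableAt_mvfderiv_apply hφ hZd) (hfd p)]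
    have := (hev hZ).mfderiv_eq (I := I) (I' := 𝓘(ℝ, E'))
    simp only [mvfderiv] at this ⊢
    rw [this]
    rfl
  apply hinj
  rw [← mvfderiv_comp_vector (hφ.mdifferentiableAt (by simp)) (hfd p),
    mvfderiv_mlieBracket hφf hX hY, mvfderiv_mlieBracket hφ hX' hY', hder hY' hYY', hder hX' hXX',
    hXX', hYY']

end Bracket

/-! ### Exterior derivatives and smooth 1-forms -/

section ExteriorDerivative

variable {E : Type*} [NormedAddCommGroup E] [NormedSpace ℝ E]
  {H : Type*} [TopologicalSpace H] {I : ModelWithCorners ℝ E H}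
  {M : Type*} [TopologicalSpace M] [ChartedSpace H M] {p : M}

theorem dirDeriv_add {X : VecField I (M := M)} {u v : M → ℝ}
    (hu : MDifferentiableAt I 𝓘(ℝ, ℝ) u p) (hv : MDifferentiableAt I 𝓘(ℝ, ℝ) v p) :
    dirDeriv X (fun q => u q + v q) p = dirDeriv X u p + dirDeriv X v p := by
  simp [dirDeriv, mvfderiv_fun_add hu hv]

theorem dirDeriv_sub {X : VecField I (M := M)} {u v : M → ℝ}
    (hu : MDifferentiableAt I 𝓘(ℝ, ℝ) u p) (hv : MDifferentiableAt I 𝓘(ℝ, ℝ) v p) :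
    dirDeriv X (fun q => u q - v q) p = dirDeriv X u p - dirDeriv X v p := by
  simp [dirDeriv, mvfderiv_fun_sub hu hv]

theorem dirDeriv_mul {X : VecField I (M := M)} {u v : M → ℝ}
    (hu : MDifferentiableAt I 𝓘(ℝ, ℝ) u p) (hv : MDifferentiableAt I 𝓘(ℝ, ℝ) v p) :
    dirDeriv X (fun q => u q * v q) p = u p * dirDeriv X v p + v p * dirDeriv X u p := by
  simp [dirDeriv, mvfderiv_fun_mul hu hv]

theorem mvfderiv_congr {F : Type*} [NormedAddCommGroup F] [NormedSpace ℝ F] {u v : M → F}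
    (h : u =ᶠ[𝓝 p] v) : mvfderiv I u p = mvfderiv I v p := by
  simp only [mvfderiv, h.mfderiv_eq]
  rfl

theorem dirDeriv_congr {X : VecField I (M := M)} {u v : M → ℝ} (h : u =ᶠ[𝓝 p] v) :
    dirDeriv X u p = dirDeriv X v p := by
  rw [dirDeriv, mvfderiv_congr h, dirDeriv]

theorem dirDeriv_mul_sub_mul {X : VecField I (M := M)} {a b c d : M → ℝ}
    (ha : MDifferentiableAt I 𝓘(ℝ, ℝ) a p) (hb : MDifferentiableAt I 𝓘(ℝ, ℝ) b p)
    (hc : MDifferentiableAt I 𝓘(ℝ, ℝ) c p) (hd : MDifferentiableAt I 𝓘(ℝ, ℝ) d p) :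
    dirDeriv X (fun q => a q * b q - c q * d q) p =
      a p * dirDeriv X b p + b p * dirDeriv X a p
        - (c p * dirDeriv X d p + d p * dirDeriv X c p) := by
  rw [← dirDeriv_mul ha hb, ← dirDeriv_mul hc hd]
  exact dirDeriv_sub (ha.mul hb) (hc.mul hd)

theorem wedge_apply (α β : OneForm I (M := M)) (v w : TangentSpace I p) :
    wedge α β p v w = α p v * β p w - β p v * α p w := by
  simp [wedge]

theorem sqForm_apply (α : OneForm I (M := M)) (v w : TangentSpace I p) :
    sqForm α p v w = α p v * α p w := by
  simp [sqForm]

/-- The Leibniz rule `d(u α) = du ∧ α + u dα`. -/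
theorem extDerivOne_smul {α : OneForm I (M := M)} {u : M → ℝ} {X Y : VecField I (M := M)}
    (hu : MDifferentiableAt I 𝓘(ℝ, ℝ) u p)
    (hX : MDifferentiableAt I 𝓘(ℝ, ℝ) (fun q => α q (X q)) p)
    (hY : MDifferentiableAt I 𝓘(ℝ, ℝ) (fun q => α q (Y q)) p) :
    extDerivOne (fun q => u q • α q) X Y p =
      dirDeriv X u p * α p (Y p) - dirDeriv Y u p * α p (X p) + u p * extDerivOne α X Y p := by
  simp only [extDerivOne, LinearMap.smul_apply, smul_eq_mul, dirDeriv_mul hu hX,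
    dirDeriv_mul hu hY]
  ring

/-- The Leibniz rule `d(α ∧ β) = dα ∧ β - α ∧ dβ`. -/
theorem extDerivTwo_wedge {α β : OneForm I (M := M)} {X Y Z : VecField I (M := M)}
    (hαX : MDifferentiableAt I 𝓘(ℝ, ℝ) (fun q => α q (X q)) p)
    (hαY : MDifferentiableAt I 𝓘(ℝ, ℝ) (fun q => α q (Y q)) p)
    (hαZ : MDifferentiableAt I 𝓘(ℝ, ℝ) (fun q => α q (Z q)) p)
    (hβX : MDifferentiableAt I 𝓘(ℝ, ℝ) (fun q => β q (X q)) p)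
    (hβY : MDifferentiableAt I 𝓘(ℝ, ℝ) (fun q => β q (Y q)) p)
    (hβZ : MDifferentiableAt I 𝓘(ℝ, ℝ) (fun q => β q (Z q)) p) :
    extDerivTwo (wedge α β) X Y Z p =
      extDerivOne α X Y p * β p (Z p) - extDerivOne α X Z p * β p (Y p)
        + extDerivOne α Y Z p * β p (X p)
        - (α p (X p) * extDerivOne β Y Z p - α p (Y p) * extDerivOne β X Z p
          + α p (Z p) * extDerivOne β X Y p) := by
  simp only [extDerivTwo, extDerivOne, wedge_apply]
  rw [dirDeriv_mul_sub_mul hαY hβZ hβY hαZ, dirDeriv_mul_sub_mul hαX hβZ hβX hαZ,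
    dirDeriv_mul_sub_mul hαX hβY hβX hαY]
  ring

theorem extDerivTwo_add {η ξ : BilinField I (M := M)} {X Y Z : VecField I (M := M)}
    (h₁ : MDifferentiableAt I 𝓘(ℝ, ℝ) (fun q => η q (Y q) (Z q)) p)
    (h₂ : MDifferentiableAt I 𝓘(ℝ, ℝ) (fun q => η q (X q) (Z q)) p)
    (h₃ : MDifferentiableAt I 𝓘(ℝ, ℝ) (fun q => η q (X q) (Y q)) p)
    (h₄ : MDifferentiableAt I 𝓘(ℝ, ℝ) (fun q => ξ q (Y q) (Z q)) p)
    (h₅ : MDifferentiableAt I 𝓘(ℝ, ℝ) (fun q => ξ q (X q) (Z q)) p)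
    (h₆ : MDifferentiableAt I 𝓘(ℝ, ℝ) (fun q => ξ q (X q) (Y q)) p) :
    extDerivTwo (η + ξ) X Y Z p = extDerivTwo η X Y Z p + extDerivTwo ξ X Y Z p := by
  simp only [extDerivTwo, Pi.add_apply, LinearMap.add_apply]
  rw [dirDeriv_add h₁ h₄, dirDeriv_add h₂ h₅, dirDeriv_add h₃ h₆]
  ring

variable [IsManifold I ∞ M]

/-- The 1-form `α` is smooth on `U`: its values on smooth (differentiable) vector fields are
smooth (differentiable). -/
structure IsSmoothFormOn (α : OneForm I (M := M)) (U : Set M) : Prop where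
  mdifferentiableAt : ∀ (X : VecField I (M := M)) (p : M), p ∈ U →
    MDifferentiableAt I I.tangent (fun q => (⟨q, X q⟩ : TangentBundle I M)) p →
    MDifferentiableAt I 𝓘(ℝ, ℝ) (fun q => α q (X q)) p
  contMDiffOn : ∀ X : VecField I (M := M), SmoothFieldOn X U →
    ContMDiffOn I 𝓘(ℝ, ℝ) ∞ (fun q => α q (X q)) U

/-- A 1-form which is smooth as a function on the tangent bundle is smooth. -/
theorem IsSmoothFormOn.of_contMDiff {α : OneForm I (M := M)}
    (hα : ContMDiff I.tangent 𝓘(ℝ, ℝ) ∞ (fun v : TangentBundle I M => α v.1 v.2)) (U : Set M) :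
    IsSmoothFormOn α U where
  mdifferentiableAt X p _ hX :=
    MDifferentiableAt.comp (I' := I.tangent) p (hα.mdifferentiable (by simp) _) hX
  contMDiffOn X hX := hα.comp_contMDiffOn hX

theorem IsSmoothFormOn.smul {α : OneForm I (M := M)} {U : Set M} (hα : IsSmoothFormOn α U)
    (hU : IsOpen U) {u : M → ℝ} (hu : ContMDiffOn I 𝓘(ℝ, ℝ) ∞ u U) :
    IsSmoothFormOn (fun q => u q • α q) U where
  mdifferentiableAt X p hp hX := by
    exact ((hu.contMDiffAt (hU.mem_nhds hp)).mdifferentiableAt (by simp)).mul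
      (hα.mdifferentiableAt X p hp hX)
  contMDiffOn X hX := by
    exact hu.mul (hα.contMDiffOn X hX)

theorem SmoothFieldOn.mdifferentiableAt {X : VecField I (M := M)} {U : Set M}
    (hX : SmoothFieldOn X U) (hU : IsOpen U) (hp : p ∈ U) :
    MDifferentiableAt I I.tangent (fun q => (⟨q, X q⟩ : TangentBundle I M)) p :=
  (ContMDiffOn.contMDiffAt hX (hU.mem_nhds hp)).mdifferentiableAt (by simp)

theorem mdifferentiableAt_wedge {α β : OneForm I (M := M)} {U : Set M}
    (hα : IsSmoothFormOn α U) (hβ : IsSmoothFormOn β U) (hp : p ∈ U) {X Y : VecField I (M := M)}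
    (hX : MDifferentiableAt I I.tangent (fun q => (⟨q, X q⟩ : TangentBundle I M)) p)
    (hY : MDifferentiableAt I I.tangent (fun q => (⟨q, Y q⟩ : TangentBundle I M)) p) :
    MDifferentiableAt I 𝓘(ℝ, ℝ) (fun q => wedge α β q (X q) (Y q)) p := by
  simp only [wedge_apply]
  exact ((hα.mdifferentiableAt X p hp hX).mul (hβ.mdifferentiableAt Y p hp hY)).sub
    ((hβ.mdifferentiableAt X p hp hX).mul (hα.mdifferentiableAt Y p hp hY))

/-- The exterior derivative of a smooth 1-form is tensorial: its value at `p` is a bilinear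
function of the values of the vector fields at `p`. -/
theorem IsSmoothFormOn.exists_bilin_extDerivOne [FiniteDimensional ℝ E]
    {α : OneForm I (M := M)} {U : Set M} (hα : IsSmoothFormOn α U) (hp : p ∈ U) :
    ∃ B : TangentSpace I p →ₗ[ℝ] TangentSpace I p →ₗ[ℝ] ℝ, ∀ X Y : VecField I (M := M),
      MDifferentiableAt I I.tangent (fun q => (⟨q, X q⟩ : TangentBundle I M)) p →
      MDifferentiableAt I I.tangent (fun q => (⟨q, Y q⟩ : TangentBundle I M)) p →
      extDerivOne α X Y p = B (X p) (Y p) := by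
  have : CompleteSpace E := FiniteDimensional.complete ℝ E
  have : IsManifold I 2 M := IsManifold.of_le (n := ∞) (by norm_cast)
  have hswap : ∀ X Y : VecField I (M := M), extDerivOne α X Y p = -extDerivOne α Y X p := by
    intro X Y
    simp only [extDerivOne]
    rw [mlieBracket_swap_apply, map_neg]
    ring
  have h1 : ∀ Y : VecField I (M := M),
      MDifferentiableAt I I.tangent (fun q => (⟨q, Y q⟩ : TangentBundle I M)) p →
      TensorialAt I E (fun X : VecField I (M := M) => extDerivOne α X Y p) p := by
    intro Y hY
    refine ⟨fun {f X} hf hX => ?_, fun {X X'} hX hX' => ?_⟩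
    · simp only [extDerivOne, mlieBracket_smul_left hf hX, Pi.smul_apply', map_smul, map_add,
        smul_eq_mul, dirDeriv_mul hf (hα.mdifferentiableAt X p hp hX)]
      simp only [dirDeriv, Pi.smul_apply', map_smul, smul_eq_mul]
      ring
    · simp only [extDerivOne, mlieBracket_add_left hX hX', Pi.add_apply, map_add,
        dirDeriv_add (hα.mdifferentiableAt X p hp hX) (hα.mdifferentiableAt X' p hp hX')]
      simp only [dirDeriv, Pi.add_apply, map_add]
      ring
  have h2 : ∀ X : VecField I (M := M),
      MDifferentiableAt I I.tangent (fun q => (⟨q, X q⟩ : TangentBundle I M)) p →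
      TensorialAt I E (fun Y : VecField I (M := M) => extDerivOne α X Y p) p := by
    intro X hX
    refine ⟨fun {f Y} hf hY => ?_, fun {Y Y'} hY hY' => ?_⟩
    · simp only [hswap X, (h1 X hX).smul hf hY, smul_neg]
    · simp only [hswap X, (h1 X hX).add hY hY', neg_add]
  refine ⟨LinearMap.mk₂ ℝ (fun v w => TensorialAt.mkHom₂ (I := I) (F := E) (F' := E)
    (fun X Y : VecField I (M := M) => extDerivOne α X Y p) p h1 h2 v w) ?_ ?_ ?_ ?_, ?_⟩
  · intros; simp
  · intros; simp
  · intros; simp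
  · intros; simp
  · intro X Y hX hY
    exact (TensorialAt.mkHom₂_apply (I := I) (F := E) (F' := E) h1 h2 hX hY).symm

end ExteriorDerivative

/-! ### Diagonal coframes -/

section Coframe

variable {E : Type*} [NormedAddCommGroup E] [NormedSpace ℝ E]
  {H : Type*} [TopologicalSpace H] {I : ModelWithCorners ℝ E H}
  {M : Type*} [TopologicalSpace M] [ChartedSpace H M] [IsManifold I ∞ M] {p : M} {U : Set M}

omit [IsManifold I ∞ M] in
theorem mvfderiv_finset_sum {ι : Type*} (s : Finset ι) {u : ι → M → ℝ}
    (hu : ∀ i, MDifferentiableAt I 𝓘(ℝ, ℝ) (u i) p) :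
    MDifferentiableAt I 𝓘(ℝ, ℝ) (fun q => ∑ i ∈ s, u i q) p ∧
    mvfderiv I (fun q => ∑ i ∈ s, u i q) p = ∑ i ∈ s, mvfderiv I (u i) p := by
  classical
  induction s using Finset.induction_on with
  | empty => simpa using ⟨mdifferentiableAt_const, mvfderiv_const 0⟩
  | insert a s ha ih =>
    simp only [Finset.sum_insert ha]
    exact ⟨(hu a).add ih.1, by rw [mvfderiv_fun_add (hu a) ih.1, ih.2]⟩

/-- The forms `F(Y, Z) = g(J Y, Z)` of a parallel endomorphism field `J` are closed, since
the exterior derivative can be computed with a torsion free connection. -/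
theorem closedTwoFormOn_of_parallel (hU : IsOpen U) {g F : BilinField I (M := M)}
    {J : EndField I (M := M)}
    {nabla : VecField I (M := M) → (p : M) → TangentSpace I p →L[ℝ] TangentSpace I p}
    (hn : IsLeviCivitaOn g nabla U) (hJ : SmoothEndOn J U) (hJp : ParallelOn nabla J U)
    (hF : ∀ p ∈ U, ∀ v w, F p v w = g p (J p v) w)
    (hskew : ∀ p ∈ U, ∀ v w, F p v w = -F p w v) :
    ClosedTwoFormOn F U := by
  intro X Y Z hX hY hZ p hp
  have key : ∀ X Y Z : VecField I (M := M), SmoothFieldOn X U → SmoothFieldOn Y U →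
      SmoothFieldOn Z U → dirDeriv X (fun q => F q (Y q) (Z q)) p =
        F p (nabla Y p (X p)) (Z p) + F p (Y p) (nabla Z p (X p)) := by
    intro X Y Z hX hY hZ
    have h1 : (fun q => F q (Y q) (Z q)) =ᶠ[𝓝 p] fun q => g q (J q (Y q)) (Z q) := by
      filter_upwards [hU.mem_nhds hp] with q hq using hF q hq _ _
    rw [dirDeriv_congr h1, hn.metric X (fun q => J q (Y q)) Z hX (hJ Y hY) hZ p hp,
      hJp Y hY p hp, ← hF p hp, ← hF p hp]
  rw [extDerivTwo, key X Y Z hX hY hZ, key Y X Z hY hX hZ, key Z X Y hZ hX hY,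
    ← hn.torsion_free X Y hX hY p hp, ← hn.torsion_free X Z hX hZ p hp,
    ← hn.torsion_free Y Z hY hZ p hp]
  simp only [map_sub, LinearMap.sub_apply]
  rw [hskew p hp (Y p) (nabla Z p (X p)), hskew p hp (X p) (nabla Z p (Y p)),
    hskew p hp (X p) (nabla Y p (Z p))]
  ring

/-- `η` is a smooth coframe on `U` with dual frame `X` and structure equations
`dηⁱ = Aᵢ η⁴ ∧ ηⁱ - Bᵢ ηʲ ∧ ηᵏ` for `(i, j, k)` cyclic and `dη⁴ = 0`. The forms `η¹, …, η⁴` are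
indexed by `0, …, 3`. -/
structure IsDiagonalCoframeOn (η : Fin 4 → OneForm I (M := M)) (X : Fin 4 → VecField I (M := M))
    (A B : Fin 3 → M → ℝ) (U : Set M) : Prop where
  isOpen : IsOpen U
  smooth_form : ∀ a, IsSmoothFormOn (η a) U
  smooth_field : ∀ a, SmoothFieldOn (X a) U
  dual : ∀ p ∈ U, ∀ a b, η a p (X b p) = if a = b then 1 else 0
  expand : ∀ p ∈ U, ∀ v, v = ∑ a, η a p v • X a p
  d₁ : ∀ p ∈ U, ∀ Y Z : VecField I (M := M),
    MDifferentiableAt I I.tangent (fun q => (⟨q, Y q⟩ : TangentBundle I M)) p →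
    MDifferentiableAt I I.tangent (fun q => (⟨q, Z q⟩ : TangentBundle I M)) p →
    extDerivOne (η 0) Y Z p =
      A 0 p * wedge (η 3) (η 0) p (Y p) (Z p) - B 0 p * wedge (η 1) (η 2) p (Y p) (Z p)
  d₂ : ∀ p ∈ U, ∀ Y Z : VecField I (M := M),
    MDifferentiableAt I I.tangent (fun q => (⟨q, Y q⟩ : TangentBundle I M)) p →
    MDifferentiableAt I I.tangent (fun q => (⟨q, Z q⟩ : TangentBundle I M)) p →
    extDerivOne (η 1) Y Z p =
      A 1 p * wedge (η 3) (η 1) p (Y p) (Z p) - B 1 p * wedge (η 2) (η 0) p (Y p) (Z p)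
  d₃ : ∀ p ∈ U, ∀ Y Z : VecField I (M := M),
    MDifferentiableAt I I.tangent (fun q => (⟨q, Y q⟩ : TangentBundle I M)) p →
    MDifferentiableAt I I.tangent (fun q => (⟨q, Z q⟩ : TangentBundle I M)) p →
    extDerivOne (η 2) Y Z p =
      A 2 p * wedge (η 3) (η 2) p (Y p) (Z p) - B 2 p * wedge (η 0) (η 1) p (Y p) (Z p)
  d₄ : ∀ p ∈ U, ∀ Y Z : VecField I (M := M),
    MDifferentiableAt I I.tangent (fun q => (⟨q, Y q⟩ : TangentBundle I M)) p →
    MDifferentiableAt I I.tangent (fun q => (⟨q, Z q⟩ : TangentBundle I M)) p →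
    extDerivOne (η 3) Y Z p = 0

/-- The value of `α ∧ β ∧ γ` on three vectors. -/
def tripleWedge (α β γ : OneForm I (M := M)) (p : M) (u v w : TangentSpace I p) : ℝ :=
  α p u * wedge β γ p v w - α p v * wedge β γ p u w + α p w * wedge β γ p u v

/-- The endomorphism field with constant matrix `L` in the frame `X` with dual coframe `η`. -/
def frameEnd (η : Fin 4 → OneForm I (M := M)) (X : Fin 4 → VecField I (M := M))
    (L : Matrix (Fin 4) (Fin 4) ℝ) : EndField I (M := M) := fun p =>
  ∑ a, (∑ b, L a b • η b p).smulRight (X a p)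

omit [IsManifold I ∞ M] in
theorem frameEnd_apply (η : Fin 4 → OneForm I (M := M)) (X : Fin 4 → VecField I (M := M))
    (L : Matrix (Fin 4) (Fin 4) ℝ) (v : TangentSpace I p) :
    frameEnd η X L p v = ∑ a, (∑ b, L a b * η b p v) • X a p := by
  simp [frameEnd]

theorem smoothFieldOn_sum_smul {X : Fin 4 → VecField I (M := M)} (hX : ∀ a, SmoothFieldOn (X a) U)
    {u : Fin 4 → M → ℝ} (hu : ∀ a, ContMDiffOn I 𝓘(ℝ, ℝ) ∞ (u a) U) :
    SmoothFieldOn (fun p => ∑ a, u a p • X a p) U :=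
  ContMDiffOn.sum_section fun a _ => (hu a).smul_section (hX a)

namespace IsDiagonalCoframeOn

variable {η : Fin 4 → OneForm I (M := M)} {X : Fin 4 → VecField I (M := M)}
  {A B : Fin 3 → M → ℝ}

theorem ext (h : IsDiagonalCoframeOn η X A B U) (hp : p ∈ U) {v w : TangentSpace I p}
    (hvw : ∀ a, η a p v = η a p w) : v = w := by
  rw [h.expand p hp v, h.expand p hp w]
  simp only [hvw]

theorem coframe_sum (h : IsDiagonalCoframeOn η X A B U) (hp : p ∈ U) (c : Fin 4 → ℝ) (a : Fin 4) :
    η a p (∑ b, c b • X b p) = c a := by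
  simp [h.dual p hp]

theorem coframe_frameEnd (h : IsDiagonalCoframeOn η X A B U) (hp : p ∈ U)
    (L : Matrix (Fin 4) (Fin 4) ℝ) (v : TangentSpace I p) (a : Fin 4) :
    η a p (frameEnd η X L p v) = ∑ b, L a b * η b p v := by
  rw [frameEnd_apply, h.coframe_sum hp]

theorem contMDiffOn_coframe (h : IsDiagonalCoframeOn η X A B U) {Y : VecField I (M := M)}
    (hY : SmoothFieldOn Y U) (a : Fin 4) : ContMDiffOn I 𝓘(ℝ, ℝ) ∞ (fun q => η a q (Y q)) U :=
  (h.smooth_form a).contMDiffOn Y hY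

theorem smoothEndOn_frameEnd (h : IsDiagonalCoframeOn η X A B U) (L : Matrix (Fin 4) (Fin 4) ℝ) :
    SmoothEndOn (frameEnd η X L) U := by
  intro Y hY
  simp only [frameEnd_apply]
  refine smoothFieldOn_sum_smul h.smooth_field fun a => ?_
  exact contMDiffOn_finsetSum fun b _ => contMDiffOn_const.mul (h.contMDiffOn_coframe hY b)

/-- A metric which is diagonal in the coframe, with nonzero constant entries. -/
theorem isPseudoMetricOn (h : IsDiagonalCoframeOn η X A B U) {g : BilinField I (M := M)}
    {s : Fin 4 → ℝ} (hs : ∀ a, s a ≠ 0)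
    (hg : ∀ p v w, g p v w = ∑ a, s a * (η a p v * η a p w)) : IsPseudoMetricOn g U where
  smooth Y Z hY hZ := by
    simp only [hg]
    exact contMDiffOn_finsetSum fun a _ => contMDiffOn_const.mul
      ((h.contMDiffOn_coframe hY a).mul (h.contMDiffOn_coframe hZ a))
  symm p _ v w := by simp only [hg, mul_comm (η _ p v)]
  nondegenerate p hp v hv := by
    refine h.ext hp fun a => ?_
    have := hv (X a p)
    simp only [hg, h.dual p hp, mul_ite, mul_one, mul_zero, Finset.sum_ite_eq', Finset.mem_univ,
      if_true] at this
    simpa [hs a] using this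

end IsDiagonalCoframeOn

end Coframe

/-! ### Closed 2-forms and hyper-symplectic structures -/

section Closed

variable {E : Type*} [NormedAddCommGroup E] [NormedSpace ℝ E]
  {H : Type*} [TopologicalSpace H] {I : ModelWithCorners ℝ E H}
  {M : Type*} [TopologicalSpace M] [ChartedSpace H M] [IsManifold I ∞ M] {p : M} {U : Set M}
  {η : Fin 4 → OneForm I (M := M)} {X : Fin 4 → VecField I (M := M)} {A B : Fin 3 → M → ℝ}

namespace IsDiagonalCoframeOn

theorem mdifferentiableAt_wedge (h : IsDiagonalCoframeOn η X A B U) (hp : p ∈ U)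
    {Y Z : VecField I (M := M)} (hY : SmoothFieldOn Y U) (hZ : SmoothFieldOn Z U) (a b : Fin 4) :
    MDifferentiableAt I 𝓘(ℝ, ℝ) (fun q => wedge (η a) (η b) q (Y q) (Z q)) p :=
  _root_.mdifferentiableAt_wedge (h.smooth_form a) (h.smooth_form b) hp
    (hY.mdifferentiableAt h.isOpen hp) (hZ.mdifferentiableAt h.isOpen hp)

theorem extDerivTwo_wedge (h : IsDiagonalCoframeOn η X A B U) (hp : p ∈ U)
    {V Y Z : VecField I (M := M)} (hV : SmoothFieldOn V U) (hY : SmoothFieldOn Y U)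
    (hZ : SmoothFieldOn Z U) (a b : Fin 4) :
    extDerivTwo (wedge (η a) (η b)) V Y Z p =
      extDerivOne (η a) V Y p * η b p (Z p) - extDerivOne (η a) V Z p * η b p (Y p)
        + extDerivOne (η a) Y Z p * η b p (V p)
        - (η a p (V p) * extDerivOne (η b) Y Z p - η a p (Y p) * extDerivOne (η b) V Z p
          + η a p (Z p) * extDerivOne (η b) V Y p) := by
  have hd : ∀ a {W : VecField I (M := M)}, SmoothFieldOn W U →
      MDifferentiableAt I 𝓘(ℝ, ℝ) (fun q => η a q (W q)) p := fun a W hW =>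
    (h.smooth_form a).mdifferentiableAt W p hp (hW.mdifferentiableAt h.isOpen hp)
  exact _root_.extDerivTwo_wedge (hd a hV) (hd a hY) (hd a hZ) (hd b hV) (hd b hY) (hd b hZ)

theorem extDerivTwo_add_wedge (h : IsDiagonalCoframeOn η X A B U) (hp : p ∈ U)
    {V Y Z : VecField I (M := M)} (hV : SmoothFieldOn V U) (hY : SmoothFieldOn Y U)
    (hZ : SmoothFieldOn Z U) (a b c d : Fin 4) :
    extDerivTwo (wedge (η a) (η b) + wedge (η c) (η d)) V Y Z p =
      extDerivTwo (wedge (η a) (η b)) V Y Z p + extDerivTwo (wedge (η c) (η d)) V Y Z p :=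
  extDerivTwo_add (h.mdifferentiableAt_wedge hp hY hZ a b) (h.mdifferentiableAt_wedge hp hV hZ a b)
    (h.mdifferentiableAt_wedge hp hV hY a b) (h.mdifferentiableAt_wedge hp hY hZ c d)
    (h.mdifferentiableAt_wedge hp hV hZ c d) (h.mdifferentiableAt_wedge hp hV hY c d)

omit [IsManifold I ∞ M] in
theorem _root_.wedge_swap (α β : OneForm I (M := M)) : -wedge α β = wedge β α := by
  funext p
  ext v w
  simp [wedge_apply]

/-- A 2-form with `dξ = c · α ∧ β ∧ γ` for three members of the coframe is closed if and only
if `c` vanishes. -/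
theorem closedTwoFormOn_iff (h : IsDiagonalCoframeOn η X A B U) {ξ : BilinField I (M := M)}
    {c : M → ℝ} {i j k : Fin 4} (hij : i ≠ j) (hik : i ≠ k) (hjk : j ≠ k)
    (hξ : ∀ p ∈ U, ∀ V Y Z : VecField I (M := M), SmoothFieldOn V U → SmoothFieldOn Y U →
      SmoothFieldOn Z U → extDerivTwo ξ V Y Z p =
        c p * tripleWedge (η i) (η j) (η k) p (V p) (Y p) (Z p)) :
    ClosedTwoFormOn ξ U ↔ ∀ p ∈ U, c p = 0 := by
  constructor
  · intro hc p hp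
    have h1 := hc (X i) (X j) (X k) (h.smooth_field i) (h.smooth_field j) (h.smooth_field k) p hp
    rw [hξ p hp _ _ _ (h.smooth_field i) (h.smooth_field j) (h.smooth_field k)] at h1
    simpa [tripleWedge, wedge_apply, h.dual p hp, hij, hik, hjk, hij.symm, hik.symm,
      hjk.symm] using h1
  · intro hc V Y Z hV hY hZ p hp
    rw [hξ p hp _ _ _ hV hY hZ, hc p hp, zero_mul]

omit [IsManifold I ∞ M] in
theorem _root_.wedge_sub_wedge (α β γ δ : OneForm I (M := M)) :
    wedge α β - wedge γ δ = wedge α β + wedge δ γ := by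
  funext p
  ext v w
  simp [wedge_apply]
  ring

theorem closedTwoFormOn_fst_snd_add (h : IsDiagonalCoframeOn η X A B U) :
    ClosedTwoFormOn (wedge (η 0) (η 1) + wedge (η 2) (η 3)) U ↔
      ∀ p ∈ U, A 0 p + A 1 p = B 2 p := by
  rw [h.closedTwoFormOn_iff (c := fun p => A 0 p + A 1 p - B 2 p) (i := 3) (j := 0) (k := 1)
    (by decide) (by decide) (by decide)]
  · simp only [sub_eq_zero]
  · intro p hp V Y Z hV hY hZ
    have hV' := hV.mdifferentiableAt h.isOpen hp
    have hY' := hY.mdifferentiableAt h.isOpen hp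
    have hZ' := hZ.mdifferentiableAt h.isOpen hp
    rw [h.extDerivTwo_add_wedge hp hV hY hZ, h.extDerivTwo_wedge hp hV hY hZ,
      h.extDerivTwo_wedge hp hV hY hZ]
    simp only [h.d₁ p hp, h.d₂ p hp, h.d₃ p hp, h.d₄ p hp, hV', hY', hZ', tripleWedge,
      wedge_apply]
    ring

theorem closedTwoFormOn_fst_snd_sub (h : IsDiagonalCoframeOn η X A B U) :
    ClosedTwoFormOn (-wedge (η 0) (η 1) + wedge (η 2) (η 3)) U ↔
      ∀ p ∈ U, A 0 p + A 1 p = -B 2 p := by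
  rw [wedge_swap, h.closedTwoFormOn_iff (c := fun p => A 0 p + A 1 p + B 2 p) (i := 3) (j := 1)
    (k := 0) (by decide) (by decide) (by decide)]
  · simp only [eq_neg_iff_add_eq_zero]
  · intro p hp V Y Z hV hY hZ
    have hV' := hV.mdifferentiableAt h.isOpen hp
    have hY' := hY.mdifferentiableAt h.isOpen hp
    have hZ' := hZ.mdifferentiableAt h.isOpen hp
    rw [h.extDerivTwo_add_wedge hp hV hY hZ, h.extDerivTwo_wedge hp hV hY hZ,
      h.extDerivTwo_wedge hp hV hY hZ]
    simp only [h.d₁ p hp, h.d₂ p hp, h.d₃ p hp, h.d₄ p hp, hV', hY', hZ', tripleWedge,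
      wedge_apply]
    ring

theorem closedTwoFormOn_fst_thd (h : IsDiagonalCoframeOn η X A B U) :
    ClosedTwoFormOn (wedge (η 0) (η 2) - wedge (η 1) (η 3)) U ↔
      ∀ p ∈ U, A 0 p + A 2 p = B 1 p := by
  rw [wedge_sub_wedge, h.closedTwoFormOn_iff (c := fun p => A 0 p + A 2 p - B 1 p)
    (i := 3) (j := 0) (k := 2) (by decide) (by decide) (by decide)]
  · simp only [sub_eq_zero]
  · intro p hp V Y Z hV hY hZ
    have hV' := hV.mdifferentiableAt h.isOpen hp
    have hY' := hY.mdifferentiableAt h.isOpen hp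
    have hZ' := hZ.mdifferentiableAt h.isOpen hp
    rw [h.extDerivTwo_add_wedge hp hV hY hZ, h.extDerivTwo_wedge hp hV hY hZ,
      h.extDerivTwo_wedge hp hV hY hZ]
    simp only [h.d₁ p hp, h.d₂ p hp, h.d₃ p hp, h.d₄ p hp, hV', hY', hZ', tripleWedge,
      wedge_apply]
    ring

theorem closedTwoFormOn_snd_thd (h : IsDiagonalCoframeOn η X A B U) :
    ClosedTwoFormOn (wedge (η 1) (η 2) + wedge (η 0) (η 3)) U ↔
      ∀ p ∈ U, A 1 p + A 2 p = B 0 p := by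
  rw [h.closedTwoFormOn_iff (c := fun p => A 1 p + A 2 p - B 0 p) (i := 3) (j := 1) (k := 2)
    (by decide) (by decide) (by decide)]
  · simp only [sub_eq_zero]
  · intro p hp V Y Z hV hY hZ
    have hV' := hV.mdifferentiableAt h.isOpen hp
    have hY' := hY.mdifferentiableAt h.isOpen hp
    have hZ' := hZ.mdifferentiableAt h.isOpen hp
    rw [h.extDerivTwo_add_wedge hp hV hY hZ, h.extDerivTwo_wedge hp hV hY hZ,
      h.extDerivTwo_wedge hp hV hY hZ]
    simp only [h.d₁ p hp, h.d₂ p hp, h.d₃ p hp, h.d₄ p hp, hV', hY', hZ', tripleWedge,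
      wedge_apply]
    ring

/-- The structure defined by the coframe is hyper-symplectic if and only if its three forms are
closed: the algebraic part is given by constant matrices in the frame. -/
theorem isHyperSymplecticOn_iff (h : IsDiagonalCoframeOn η X A B U) :
    IsHyperSymplecticOn (sqForm (η 0) + sqForm (η 1) - sqForm (η 2) - sqForm (η 3))
      (-wedge (η 0) (η 1) + wedge (η 2) (η 3)) (wedge (η 0) (η 2) - wedge (η 1) (η 3))
      (wedge (η 1) (η 2) + wedge (η 0) (η 3)) U ↔
    ∀ p ∈ U, A 0 p + A 1 p = -B 2 p ∧ A 0 p + A 2 p = B 1 p ∧ A 1 p + A 2 p = B 0 p := by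
  constructor
  · rintro ⟨J, P₁, P₂, -, -, -, -, h1, h2, h3⟩ p hp
    exact ⟨h.closedTwoFormOn_fst_snd_sub.1 h1 p hp, h.closedTwoFormOn_fst_thd.1 h2 p hp,
      h.closedTwoFormOn_snd_thd.1 h3 p hp⟩
  · intro hAB
    have hL := fun p hp L v a => h.coframe_frameEnd (p := p) hp L v a
    refine ⟨frameEnd η X !![0, -1, 0, 0; 1, 0, 0, 0; 0, 0, 0, -1; 0, 0, 1, 0],
      frameEnd η X !![0, 0, 1, 0; 0, 0, 0, -1; 1, 0, 0, 0; 0, -1, 0, 0],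
      frameEnd η X !![0, 0, 0, 1; 0, 0, 1, 0; 0, 1, 0, 0; 1, 0, 0, 0],
      ⟨h.isPseudoMetricOn (s := ![1, 1, -1, -1]) ?_ ?_, h.smoothEndOn_frameEnd _,
        h.smoothEndOn_frameEnd _, h.smoothEndOn_frameEnd _, ?_, ?_, ?_, ?_, ?_, ?_, ?_, ?_⟩,
      ?_, ?_, ?_, h.closedTwoFormOn_fst_snd_sub.2 fun p hp => (hAB p hp).1,
      h.closedTwoFormOn_fst_thd.2 fun p hp => (hAB p hp).2.1,
      h.closedTwoFormOn_snd_thd.2 fun p hp => (hAB p hp).2.2⟩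
    · intro a; fin_cases a <;> simp
    · intro p v w
      simp [Fin.sum_univ_four, sqForm_apply]
      ring
    iterate 5
      intro p hp v
      refine h.ext hp fun a => ?_
      fin_cases a <;> simp [hL p hp, Fin.sum_univ_four]
    all_goals
      intro p hp v w
      simp [hL p hp, Fin.sum_univ_four, sqForm_apply, wedge_apply]
      try ring

end IsDiagonalCoframeOn

end Closed

/-! ### The Levi-Civita connection and hyper-Kähler structures -/

section Connection

variable {E : Type*} [NormedAddCommGroup E] [NormedSpace ℝ E] [FiniteDimensional ℝ E]
  {H : Type*} [TopologicalSpace H] {I : ModelWithCorners ℝ E H}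
  {M : Type*} [TopologicalSpace M] [ChartedSpace H M] {p : M} {U : Set M}

/-- The value at `p` of a 1-form as a continuous linear map. -/
def OneForm.toCLM (α : OneForm I (M := M)) (p : M) : TangentSpace I p →L[ℝ] ℝ :=
  have : FiniteDimensional ℝ (TangentSpace I p) := inferInstanceAs (FiniteDimensional ℝ E)
  have : T2Space (TangentSpace I p) := inferInstanceAs (T2Space E)
  LinearMap.toContinuousLinearMap (α p)

theorem OneForm.toCLM_apply (α : OneForm I (M := M)) (p : M) (v : TangentSpace I p) :
    OneForm.toCLM α p v = α p v := rfl

/-- The connection `∇ Y = ∑ₐ (d(ηᵃ(Y)) + ∑_b Γᵃ_b ηᵇ(Y)) Xₐ` with connection forms `Γᵃ_b` in the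
frame `X` with dual coframe `η`. -/
def frameConnection (η : Fin 4 → OneForm I (M := M)) (X : Fin 4 → VecField I (M := M))
    (Γ : Fin 4 → Fin 4 → OneForm I (M := M)) (Y : VecField I (M := M)) (p : M) :
    TangentSpace I p →L[ℝ] TangentSpace I p :=
  ∑ a, (mvfderiv I (fun q => η a q (Y q)) p
    + ∑ b, η b p (Y p) • OneForm.toCLM (Γ a b) p).smulRight (X a p)

theorem frameConnection_apply (η : Fin 4 → OneForm I (M := M)) (X : Fin 4 → VecField I (M := M))
    (Γ : Fin 4 → Fin 4 → OneForm I (M := M)) (Y : VecField I (M := M)) (v : TangentSpace I p) :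
    frameConnection η X Γ Y p v = ∑ a, (mvfderiv I (fun q => η a q (Y q)) p v
      + ∑ b, η b p (Y p) * Γ a b p v) • X a p := by
  simp [frameConnection, OneForm.toCLM_apply]

variable [IsManifold I ∞ M]
  {η : Fin 4 → OneForm I (M := M)} {X : Fin 4 → VecField I (M := M)} {A B : Fin 3 → M → ℝ}
  {Γ : Fin 4 → Fin 4 → OneForm I (M := M)}

namespace IsDiagonalCoframeOn

theorem coframe_frameConnection (h : IsDiagonalCoframeOn η X A B U) (hp : p ∈ U)
    (Y : VecField I (M := M)) (v : TangentSpace I p) (a : Fin 4) :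
    η a p (frameConnection η X Γ Y p v) =
      mvfderiv I (fun q => η a q (Y q)) p v + ∑ b, η b p (Y p) * Γ a b p v := by
  rw [frameConnection_apply, h.coframe_sum hp]

/-- Skew-symmetric connection forms satisfying `dηᵃ = -∑_b Γᵃ_b ∧ ηᵇ` define the Levi-Civita
connection of the metric `∑ₐ (ηᵃ)²`. -/
theorem isLeviCivitaOn_frameConnection (h : IsDiagonalCoframeOn η X A B U)
    {g : BilinField I (M := M)} (hg : ∀ p v w, g p v w = ∑ a, η a p v * η a p w)
    (hskew : ∀ p ∈ U, ∀ a b v, Γ a b p v = -Γ b a p v)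
    (hd : ∀ p ∈ U, ∀ Y Z : VecField I (M := M),
      MDifferentiableAt I I.tangent (fun q => (⟨q, Y q⟩ : TangentBundle I M)) p →
      MDifferentiableAt I I.tangent (fun q => (⟨q, Z q⟩ : TangentBundle I M)) p →
      ∀ a, extDerivOne (η a) Y Z p = -∑ b, wedge (Γ a b) (η b) p (Y p) (Z p)) :
    IsLeviCivitaOn g (frameConnection η X Γ) U where
  cov :=
    { add := by
        intro σ σ' p hσ hσ' hp
        ext v
        refine h.ext hp fun a => ?_
        have h1 := (h.smooth_form a).mdifferentiableAt σ p hp hσ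
        have h2 := (h.smooth_form a).mdifferentiableAt σ' p hp hσ'
        rw [add_apply, map_add]
        simp only [h.coframe_frameConnection hp, Pi.add_apply, map_add]
        rw [mvfderiv_fun_add h1 h2]
        simp only [add_apply, add_mul, Finset.sum_add_distrib]
        ring
      leibniz := by
        intro σ f p hσ hf hp
        ext v
        refine h.ext hp fun a => ?_
        have h1 := (h.smooth_form a).mdifferentiableAt σ p hp hσ
        rw [add_apply, map_add]
        simp only [h.coframe_frameConnection hp, Pi.smul_apply', map_smul, smul_eq_mul,
          smul_apply, ContinuousLinearMap.smulRight_apply]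
        rw [mvfderiv_fun_mul hf h1]
        simp only [add_apply, smul_apply, smul_eq_mul,
          mul_add, Finset.mul_sum, mul_assoc]
        ring }
  torsion_free := by
    intro Y Z hY hZ p hp
    refine h.ext hp fun a => ?_
    have h1 := hd p hp Y Z (hY.mdifferentiableAt h.isOpen hp) (hZ.mdifferentiableAt h.isOpen hp) a
    simp only [extDerivOne, dirDeriv, wedge_apply] at h1
    rw [map_sub, h.coframe_frameConnection hp, h.coframe_frameConnection hp]
    have h2 : ∑ b, (Γ a b p (Y p) * η b p (Z p) - η b p (Y p) * Γ a b p (Z p)) =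
        ∑ b, η b p (Z p) * Γ a b p (Y p) - ∑ b, η b p (Y p) * Γ a b p (Z p) := by
      rw [← Finset.sum_sub_distrib]
      exact Finset.sum_congr rfl fun b _ => by ring
    linarith
  metric := by
    intro V Y Z hV hY hZ p hp
    have hdY := fun a => (h.smooth_form a).mdifferentiableAt Y p hp
      (hY.mdifferentiableAt h.isOpen hp)
    have hdZ := fun a => (h.smooth_form a).mdifferentiableAt Z p hp
      (hZ.mdifferentiableAt h.isOpen hp)
    simp only [hg, h.coframe_frameConnection hp, dirDeriv]
    have h3 := (mvfderiv_finset_sum (u := fun a q => η a q (Y q) * η a q (Z q)) Finset.univ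
      fun a => (hdY a).mul (hdZ a)).2
    have h1 : ∀ a, mvfderiv I (fun q => η a q (Y q) * η a q (Z q)) p (V p) =
        η a p (Y p) * mvfderiv I (fun q => η a q (Z q)) p (V p)
          + η a p (Z p) * mvfderiv I (fun q => η a q (Y q)) p (V p) := fun a =>
      dirDeriv_mul (X := V) (hdY a) (hdZ a)
    have h2 : ∑ a, (∑ b, η b p (Y p) * Γ a b p (V p)) * η a p (Z p) =
        -∑ a, η a p (Y p) * ∑ b, η b p (Z p) * Γ a b p (V p) := by
      simp only [Finset.sum_mul, Finset.mul_sum]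
      rw [Finset.sum_comm, ← Finset.sum_neg_distrib]
      refine Finset.sum_congr rfl fun a _ => ?_
      rw [← Finset.sum_neg_distrib]
      refine Finset.sum_congr rfl fun b _ => ?_
      rw [hskew p hp b a]
      ring
    refine (congrArg (fun T => T (V p)) h3).trans ?_
    simp only [sum_apply]
    refine (Finset.sum_congr rfl fun a _ => h1 a).trans ?_
    simp only [add_mul, mul_add, Finset.sum_add_distrib, h2]
    simp only [mul_comm]
    ring

/-- An endomorphism field with constant matrix in the frame is parallel as soon as its matrix
commutes with the connection matrix. -/
theorem parallelOn_frameEnd (h : IsDiagonalCoframeOn η X A B U) {L : Matrix (Fin 4) (Fin 4) ℝ}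
    (hL : ∀ p ∈ U, ∀ v : TangentSpace I p, ∀ a b,
      ∑ c, Γ a c p v * L c b = ∑ c, L a c * Γ c b p v) :
    ParallelOn (frameConnection η X Γ) (frameEnd η X L) U := by
  intro Y hY p hp v
  refine h.ext hp fun a => ?_
  have hdY := fun b => (h.smooth_form b).mdifferentiableAt Y p hp
    (hY.mdifferentiableAt h.isOpen hp)
  rw [h.coframe_frameEnd hp]
  simp only [h.coframe_frameConnection hp, h.coframe_frameEnd hp]
  have h1 : (fun q => η a q (frameEnd η X L q (Y q))) =ᶠ[𝓝 p]
      fun q => ∑ b, L a b * η b q (Y q) := by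
    filter_upwards [h.isOpen.mem_nhds hp] with q hq using h.coframe_frameEnd hq L _ a
  have h2 : mvfderiv I (fun q => η a q (frameEnd η X L q (Y q))) p v =
      ∑ b, L a b * mvfderiv I (fun q => η b q (Y q)) p v := by
    have h3 := (mvfderiv_finset_sum Finset.univ fun b =>
      (mdifferentiableAt_const (c := L a b) (x := p)).mul (hdY b)).2
    rw [mvfderiv_congr h1]
    refine (congrArg (fun T => T v) h3).trans ?_
    rw [sum_apply]
    refine Finset.sum_congr rfl fun b _ => ?_
    have h5 := mvfderiv_fun_mul (mdifferentiableAt_const (I := I) (c := L a b) (x := p)) (hdY b)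
    refine (congrArg (fun T => T v) h5).trans ?_
    simp [mvfderiv_const]
  rw [h2]
  simp only [mul_add, Finset.sum_add_distrib, Finset.mul_sum, Finset.sum_mul]
  congr 1
  rw [Finset.sum_comm]
  conv_rhs => rw [Finset.sum_comm]
  refine Finset.sum_congr rfl fun b _ => ?_
  have := congrArg (fun t => η b p (Y p) * t) (hL p hp v a b)
  simp only [Finset.mul_sum] at this
  refine Eq.trans (Finset.sum_congr rfl fun c _ => ?_)
    (this.trans (Finset.sum_congr rfl fun c _ => ?_)) <;> ring

/-- The structure defined by the coframe is hyper-Kähler if and only if its three forms are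
closed. If they are, the connection matrix of the Levi-Civita connection is a combination of three
constant matrices which commute with the matrices of `J₁, J₂, J₃`. -/
theorem isHyperKahlerOn_iff (h : IsDiagonalCoframeOn η X A B U) :
    IsHyperKahlerOn (sqForm (η 0) + sqForm (η 1) + sqForm (η 2) + sqForm (η 3))
      (wedge (η 0) (η 1) + wedge (η 2) (η 3)) (wedge (η 0) (η 2) - wedge (η 1) (η 3))
      (wedge (η 1) (η 2) + wedge (η 0) (η 3)) U ↔
    ∀ p ∈ U, A 0 p + A 1 p = B 2 p ∧ A 0 p + A 2 p = B 1 p ∧ A 1 p + A 2 p = B 0 p := by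
  constructor
  · rintro ⟨J₁, J₂, J₃, hJ, hF₁, hF₂, hF₃, nabla, hn, h₁, h₂, h₃⟩ p hp
    refine ⟨h.closedTwoFormOn_fst_snd_add.1 (closedTwoFormOn_of_parallel h.isOpen hn hJ.smooth₁ h₁
        hF₁ ?_) p hp,
      h.closedTwoFormOn_fst_thd.1 (closedTwoFormOn_of_parallel h.isOpen hn hJ.smooth₂ h₂
        hF₂ ?_) p hp,
      h.closedTwoFormOn_snd_thd.1 (closedTwoFormOn_of_parallel h.isOpen hn hJ.smooth₃ h₃
        hF₃ ?_) p hp⟩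
    all_goals
      intro q hq v w
      simp [wedge_apply]
      ring
  · intro hAB
    have hL := fun p hp L v a => h.coframe_frameEnd (p := p) hp L v a
    have hg : ∀ p v w, (sqForm (η 0) + sqForm (η 1) + sqForm (η 2) + sqForm (η 3)) p v w =
        ∑ a, η a p v * η a p w := by
      intro p v w
      simp [Fin.sum_univ_four, sqForm_apply]
    -- The connection forms: `Γⁱ₄ = Aᵢ ηⁱ` and `Γⁱⱼ = -A_k ηᵏ` for `(i, j, k)` cyclic.
    let K : Fin 3 → Matrix (Fin 4) (Fin 4) ℝ :=
      ![!![0, 0, 0, 1; 0, 0, -1, 0; 0, 1, 0, 0; -1, 0, 0, 0],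
        !![0, 0, 1, 0; 0, 0, 0, 1; -1, 0, 0, 0; 0, -1, 0, 0],
        !![0, -1, 0, 0; 1, 0, 0, 0; 0, 0, 0, 1; 0, 0, -1, 0]]
    let Γ : Fin 4 → Fin 4 → OneForm I (M := M) := fun a b p =>
      ∑ i : Fin 3, (K i a b * A i p) • η i.castSucc p
    have hΓ : ∀ p a b v, Γ a b p v = K 0 a b * A 0 p * η 0 p v + K 1 a b * A 1 p * η 1 p v
        + K 2 a b * A 2 p * η 2 p v := by
      intro p a b v
      simp only [Γ, Fin.sum_univ_three, LinearMap.add_apply, LinearMap.smul_apply, smul_eq_mul]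
      rfl
    refine ⟨frameEnd η X !![0, -1, 0, 0; 1, 0, 0, 0; 0, 0, 0, -1; 0, 0, 1, 0],
      frameEnd η X !![0, 0, -1, 0; 0, 0, 0, 1; 1, 0, 0, 0; 0, -1, 0, 0],
      frameEnd η X !![0, 0, 0, -1; 0, 0, -1, 0; 0, 1, 0, 0; 1, 0, 0, 0],
      ⟨h.isPseudoMetricOn (s := 1) (by simp) (by simpa using hg), ?_, h.smoothEndOn_frameEnd _,
        h.smoothEndOn_frameEnd _, h.smoothEndOn_frameEnd _, ?_, ?_, ?_, ?_, ?_, ?_, ?_, ?_⟩,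
      ?_, ?_, ?_, frameConnection η X Γ, h.isLeviCivitaOn_frameConnection hg ?_ ?_,
      h.parallelOn_frameEnd ?_, h.parallelOn_frameEnd ?_, h.parallelOn_frameEnd ?_⟩
    · intro p hp v hv
      rw [hg]
      obtain ⟨a, ha⟩ : ∃ a, η a p v ≠ 0 := by
        by_contra! hc
        exact hv (h.ext hp fun a => by rw [hc a, map_zero])
      exact Finset.sum_pos' (fun b _ => mul_self_nonneg _)
        ⟨a, Finset.mem_univ _, mul_self_pos.2 ha⟩
    iterate 5
      intro p hp v
      refine h.ext hp fun a => ?_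
      fin_cases a <;> simp [hL p hp, Fin.sum_univ_four]
    iterate 6
      intro p hp v w
      simp [hL p hp, Fin.sum_univ_four, sqForm_apply, wedge_apply]
      try ring
    · intro p hp a b v
      simp only [hΓ]
      fin_cases a <;> fin_cases b <;> simp [K]
    · intro p hp Y Z hY hZ a
      obtain ⟨h1, h2, h3⟩ := hAB p hp
      simp only [Fin.sum_univ_four, wedge_apply, hΓ]
      fin_cases a
      · refine (h.d₁ p hp Y Z hY hZ).trans ?_
        simp [K, wedge_apply, ← h3]
        ring
      · refine (h.d₂ p hp Y Z hY hZ).trans ?_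
        simp [K, wedge_apply, ← h2]
        ring
      · refine (h.d₃ p hp Y Z hY hZ).trans ?_
        simp [K, wedge_apply, ← h1]
        ring
      · refine (h.d₄ p hp Y Z hY hZ).trans ?_
        simp [K]
        ring
    all_goals
      intro p hp v a b
      simp only [hΓ]
      fin_cases a <;> fin_cases b <;> simp [K, Fin.sum_univ_four]

end IsDiagonalCoframeOn

end Connection

/-! ### Left-invariant forms and vector fields -/

section Group

open Bundle

variable {G : Type*} [TopologicalSpace G] [ChartedSpace (EuclideanSpace ℝ (Fin 3)) G] [Group G]
  [LieGroup (𝓡 3) ∞ G]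

/-- The differential of the multiplication maps `(0, v)`, tangent at `(g, a)`, to the left
translate of `v` by `g`. -/
theorem tangentMap_mul_zero_left (g a : G) (v : TangentSpace (𝓡 3) a) :
    tangentMap ((𝓡 3).prod (𝓡 3)) (𝓡 3) (fun p : G × G => p.1 * p.2)
        ((equivTangentBundleProd (𝓡 3) G (𝓡 3) G).symm (⟨g, 0⟩, ⟨a, v⟩)) =
      (⟨g * a, mfderiv (𝓡 3) (𝓡 3) (fun h => g * h) a v⟩ : TangentBundle (𝓡 3) G) := by
  refine congrArg (fun u => (⟨g * a, u⟩ : TangentBundle (𝓡 3) G)) ?_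
  refine (mfderiv_prod_eq_add_apply (I := 𝓡 3) (I' := 𝓡 3) (p := (g, a))
    (v := ((0, v) : EuclideanSpace ℝ (Fin 3) × EuclideanSpace ℝ (Fin 3)))
    ((contMDiff_mul (𝓡 3) ∞).mdifferentiableAt (by simp))).trans ?_
  refine (congrArg (fun u => u + mfderiv (𝓡 3) (𝓡 3) (fun h => g * h) a v)
    (map_zero (mfderiv (𝓡 3) (𝓡 3) (fun h => h * a) g))).trans ?_
  exact zero_add _

omit [Group G] [LieGroup (𝓡 3) ∞ G] in
theorem TangentBundle.mk_congr_point {g h : G} (hgh : g = h) (v : EuclideanSpace ℝ (Fin 3)) :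
    (⟨g, v⟩ : TangentBundle (𝓡 3) G) = ⟨h, v⟩ := by
  subst hgh; rfl

/-- Left-invariant vector fields are smooth. Mathlib's version of this gives only the
finite regularity `minSmoothness ℝ 2`. -/
theorem smoothFieldOn_mulInvariantVectorField (v : GroupLieAlgebra (𝓡 3) G) (U : Set G) :
    SmoothFieldOn (mulInvariantVectorField (I := 𝓡 3) (G := G) v) U := by
  have s₁ : ContMDiff (𝓡 3) ((𝓡 3).tangent.prod (𝓡 3).tangent) ∞ fun g : G =>
      ((⟨g, 0⟩ : TangentBundle (𝓡 3) G), (⟨1, v⟩ : TangentBundle (𝓡 3) G)) :=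
    (contMDiff_zeroSection _ _).prodMk contMDiff_const
  have s₂ : ContMDiff ((𝓡 3).tangent.prod (𝓡 3).tangent) ((𝓡 3).prod (𝓡 3)).tangent ∞
      (equivTangentBundleProd (𝓡 3) G (𝓡 3) G).symm := contMDiff_equivTangentBundleProd_symm
  have s₃ : ContMDiff ((𝓡 3).prod (𝓡 3)).tangent (𝓡 3).tangent ∞
      (tangentMap ((𝓡 3).prod (𝓡 3)) (𝓡 3) (fun p : G × G => p.1 * p.2)) :=
    (contMDiff_mul (𝓡 3) ∞).contMDiff_tangentMap (by simp)
  exact (((s₃.comp s₂).comp s₁).congr fun g =>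
    ((tangentMap_mul_zero_left g 1 v).trans
      (TangentBundle.mk_congr_point (mul_one g) _)).symm).contMDiffOn

omit [Group G] [LieGroup (𝓡 3) ∞ G] in
theorem OneForm.congr_point (α : OneForm (𝓡 3) (M := G)) {g h : G} (hgh : g = h)
    (v : EuclideanSpace ℝ (Fin 3)) : α g v = α h v := by
  subst hgh; rfl

/-- A left-invariant 1-form is smooth as a function on the tangent bundle: it is the composition
of its value at `1` with the Maurer-Cartan map `v ↦ g⁻¹ v` for `v` tangent at `g`. -/
theorem IsLeftInvariantForm.contMDiff {α : OneForm (𝓡 3) (M := G)} (hα : IsLeftInvariantForm α) :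
    ContMDiff (𝓡 3).tangent 𝓘(ℝ, ℝ) ∞ (fun v : TangentBundle (𝓡 3) G => α v.1 v.2) := by
  let m : TangentBundle (𝓡 3) G → TangentBundle (𝓡 3) G := fun v =>
    tangentMap ((𝓡 3).prod (𝓡 3)) (𝓡 3) (fun p : G × G => p.1 * p.2)
      ((equivTangentBundleProd (𝓡 3) G (𝓡 3) G).symm (⟨v.1⁻¹, 0⟩, v))
  have s₃ : ContMDiff ((𝓡 3).prod (𝓡 3)).tangent (𝓡 3).tangent ∞
      (tangentMap ((𝓡 3).prod (𝓡 3)) (𝓡 3) (fun p : G × G => p.1 * p.2)) :=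
    (contMDiff_mul (𝓡 3) ∞).contMDiff_tangentMap (by simp)
  have s₁ : ContMDiff (𝓡 3).tangent ((𝓡 3).tangent.prod (𝓡 3).tangent) ∞
      fun v : TangentBundle (𝓡 3) G => ((⟨v.1⁻¹, 0⟩ : TangentBundle (𝓡 3) G), v) :=
    (((contMDiff_zeroSection ℝ (TangentSpace (𝓡 3) : G → Type _)).comp
      (contMDiff_inv (𝓡 3) ∞)).comp (contMDiff_proj (TangentSpace (𝓡 3)))).prodMk contMDiff_id
  have hm : ContMDiff (𝓡 3).tangent (𝓡 3).tangent ∞ m :=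
    (s₃.comp contMDiff_equivTangentBundleProd_symm).comp s₁
  have hm1 : ∀ v, (m v).1 = 1 := fun v => inv_mul_cancel v.1
  have hm2 : ∀ v, α (m v).1 (m v).2 = α v.1 v.2 := by
    intro v
    exact (congrArg (fun w : TangentBundle (𝓡 3) G => α w.1 w.2)
      (tangentMap_mul_zero_left v.1⁻¹ v.1 v.2)).trans (hα v.1⁻¹ v.1 v.2)
  have hα1 : ContDiff ℝ ∞ (fun w : EuclideanSpace ℝ (Fin 3) => α 1 w) :=
    (LinearMap.toContinuousLinearMap
      (show EuclideanSpace ℝ (Fin 3) →ₗ[ℝ] ℝ from α 1)).contDiff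
  intro v
  have h1 := (contMDiffAt_totalSpace.1 (hm v)).2
  refine (hα1.contMDiff.contMDiffAt.comp v h1).congr_of_eventuallyEq
    (Eventually.of_forall fun w => ?_)
  refine (hm2 w).symm.trans ((OneForm.congr_point α (hm1 w) _).trans ?_)
  refine congrArg (fun u : EuclideanSpace ℝ (Fin 3) => α 1 u) ?_
  have h2 : (m w).1 = (m v).1 := by rw [hm1, hm1]
  have h3 : (m w).1 ∈ (tangentBundleCore (𝓡 3) G).baseSet (achart _ (m w).1) :=
    mem_chart_source _ _
  have h4 : (trivializationAt (EuclideanSpace ℝ (Fin 3)) (TangentSpace (𝓡 3)) (m v).1 (m w)).2 =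
      (tangentBundleCore (𝓡 3) G).coordChange (achart _ (m w).1) (achart _ (m v).1)
        (m w).1 (m w).2 := rfl
  refine Eq.trans ?_ h4.symm
  rw [← h2]
  exact ((tangentBundleCore (𝓡 3) G).coordChange_self _ _ h3 _).symm

/-- On an `n`-dimensional space, `n` independent linear forms have a dual basis. -/
theorem exists_dual_vectors {V : Type*} [AddCommGroup V] [Module ℝ V] [FiniteDimensional ℝ V]
    {n : ℕ} (hV : Module.finrank ℝ V = n) {e : Fin n → V →ₗ[ℝ] ℝ} (he : LinearIndependent ℝ e) :
    ∃ v : Fin n → V, (∀ i j, e i (v j) = if i = j then 1 else 0) ∧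
      ∀ w, (∀ i, e i w = 0) → w = 0 := by
  classical
  have hcard : Fintype.card (Fin n) = Module.finrank ℝ (Module.Dual ℝ V) := by
    rw [Subspace.dual_finrank_eq, hV, Fintype.card_fin]
  let b : Module.Basis (Fin n) ℝ (Module.Dual ℝ V) :=
    basisOfLinearIndependentOfCardEqFinrank' e he hcard
  have hb : ∀ i, b i = e i := fun i => by simp [b]
  refine ⟨fun j => (Module.evalEquiv ℝ V).symm (b.dualBasis j), fun i j => ?_, fun w hw => ?_⟩
  · rw [← hb i]
    simp [Finsupp.single_apply]
  · rw [← Module.forall_dual_apply_eq_zero_iff ℝ w]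
    intro φ
    rw [← b.sum_repr φ]
    simp [hb, hw]

/-- Three independent left-invariant forms on a three-dimensional Lie group have a smooth dual
frame. -/
theorem exists_dual_frame {e : Fin 3 → OneForm (𝓡 3) (M := G)}
    (he : ∀ i, IsLeftInvariantForm (e i)) (hi : ∀ g, LinearIndependent ℝ (fun i => e i g)) :
    ∃ V : Fin 3 → VecField (𝓡 3) (M := G), (∀ i, SmoothFieldOn (V i) univ) ∧
      (∀ g i j, e i g (V j g) = if i = j then 1 else 0) ∧
      ∀ g v, v = ∑ i, e i g v • V i g := by
  have hfin : ∀ g : G, FiniteDimensional ℝ (TangentSpace (𝓡 3) g) := fun g =>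
    inferInstanceAs (FiniteDimensional ℝ (EuclideanSpace ℝ (Fin 3)))
  have hrank : ∀ g : G, Module.finrank ℝ (TangentSpace (𝓡 3) g) = 3 := fun g =>
    finrank_euclideanSpace_fin (𝕜 := ℝ) (n := 3)
  obtain ⟨v, hv, -⟩ := exists_dual_vectors (hrank 1) (hi 1)
  have hdual : ∀ g i j, e i g (mulInvariantVectorField (v j) g) = if i = j then 1 else 0 := by
    intro g i j
    rw [← hv i j, ← he i g 1 (v j)]
    exact OneForm.congr_point (e i) (mul_one g).symm _
  refine ⟨fun i => mulInvariantVectorField (v i),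
    fun i => smoothFieldOn_mulInvariantVectorField (v i) univ, hdual, fun g w => ?_⟩
  obtain ⟨-, -, hz⟩ := exists_dual_vectors (hrank g) (hi g)
  refine sub_eq_zero.1 (hz _ fun i => ?_)
  simp [hdual]

/-! ### The product with the real line -/

omit [Group G] [LieGroup (𝓡 3) ∞ G] in
/-- The vector field `V + c ∂ₜ` on `G × ℝ`, for a vector field `V` on `G` and a constant `c`. -/
def liftField (V : VecField (𝓡 3) (M := G)) (c : ℝ) :
    VecField ((𝓡 3).prod 𝓘(ℝ, ℝ)) (M := G × ℝ) := fun p =>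
  ((V p.1, c) : EuclideanSpace ℝ (Fin 3) × ℝ)

/-- The pull-back to `G × ℝ` of a 1-form on `G`. -/
def pullFst (α : OneForm (𝓡 3) (M := G)) : OneForm ((𝓡 3).prod 𝓘(ℝ, ℝ)) (M := G × ℝ) := fun p =>
  α p.1 ∘ₗ (mfderiv ((𝓡 3).prod 𝓘(ℝ, ℝ)) (𝓡 3) (Prod.fst : G × ℝ → G) p).toLinearMap

variable (G) in
/-- The 1-form `dt` on `G × ℝ`. -/
def dtForm : OneForm ((𝓡 3).prod 𝓘(ℝ, ℝ)) (M := G × ℝ) := fun p =>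
  (mvfderiv ((𝓡 3).prod 𝓘(ℝ, ℝ)) (Prod.snd : G × ℝ → ℝ) p).toLinearMap

omit [Group G] [LieGroup (𝓡 3) ∞ G] in
theorem pullFst_apply (α : OneForm (𝓡 3) (M := G)) (p : G × ℝ)
    (v : TangentSpace ((𝓡 3).prod 𝓘(ℝ, ℝ)) p) :
    pullFst α p v = α p.1 (show EuclideanSpace ℝ (Fin 3) × ℝ from v).1 := by
  simp only [pullFst, mfderiv_fst]
  rfl

omit [Group G] [LieGroup (𝓡 3) ∞ G] in
theorem dtForm_apply (p : G × ℝ) (v : TangentSpace ((𝓡 3).prod 𝓘(ℝ, ℝ)) p) :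
    dtForm G p v = (show EuclideanSpace ℝ (Fin 3) × ℝ from v).2 := by
  simp only [dtForm, mvfderiv, mfderiv_snd]
  rfl

theorem smoothFieldOn_liftField {V : VecField (𝓡 3) (M := G)} (hV : SmoothFieldOn V univ) (c : ℝ)
    (U : Set (G × ℝ)) : SmoothFieldOn (liftField V c) U := by
  have h1 : ContMDiff (𝓡 3) (𝓡 3).tangent ∞ fun g => (⟨g, V g⟩ : TangentBundle (𝓡 3) G) :=
    contMDiffOn_univ.1 hV
  have h2 : ContMDiff 𝓘(ℝ, ℝ) 𝓘(ℝ, ℝ).tangent ∞ fun t : ℝ => (⟨t, c⟩ : TangentBundle 𝓘(ℝ, ℝ) ℝ) :=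
    contMDiff_vectorSpace_iff_contDiff.2 contDiff_const
  exact ((contMDiff_equivTangentBundleProd_symm (I := 𝓡 3) (M := G) (I' := 𝓘(ℝ, ℝ)) (M' := ℝ)
    (n := ∞)).comp ((h1.comp contMDiff_fst).prodMk (h2.comp contMDiff_snd))).contMDiffOn

theorem isSmoothFormOn_pullFst {α : OneForm (𝓡 3) (M := G)} (hα : IsLeftInvariantForm α)
    (U : Set (G × ℝ)) : IsSmoothFormOn (pullFst α) U := by
  refine IsSmoothFormOn.of_contMDiff ?_ U
  have h : ContMDiff ((𝓡 3).prod 𝓘(ℝ, ℝ)).tangent (𝓡 3).tangent ∞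
      (tangentMap ((𝓡 3).prod 𝓘(ℝ, ℝ)) (𝓡 3) (Prod.fst : G × ℝ → G)) :=
    contMDiff_fst.contMDiff_tangentMap (n := ∞) (by simp)
  exact hα.contMDiff.comp h

theorem isSmoothFormOn_dtForm (U : Set (G × ℝ)) : IsSmoothFormOn (dtForm G) U := by
  refine IsSmoothFormOn.of_contMDiff ?_ U
  have h : ContMDiff ((𝓡 3).prod 𝓘(ℝ, ℝ)).tangent 𝓘(ℝ, ℝ).tangent ∞
      (tangentMap ((𝓡 3).prod 𝓘(ℝ, ℝ)) 𝓘(ℝ, ℝ) (Prod.snd : G × ℝ → ℝ)) :=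
    contMDiff_snd.contMDiff_tangentMap (n := ∞) (by simp)
  exact (contMDiff_snd_tangentBundle_modelSpace ℝ 𝓘(ℝ, ℝ)).comp h

theorem extDerivOne_dtForm {p : G × ℝ} {Y Z : VecField ((𝓡 3).prod 𝓘(ℝ, ℝ)) (M := G × ℝ)}
    (hY : MDifferentiableAt ((𝓡 3).prod 𝓘(ℝ, ℝ)) ((𝓡 3).prod 𝓘(ℝ, ℝ)).tangent
      (fun q => (⟨q, Y q⟩ : TangentBundle ((𝓡 3).prod 𝓘(ℝ, ℝ)) (G × ℝ))) p)
    (hZ : MDifferentiableAt ((𝓡 3).prod 𝓘(ℝ, ℝ)) ((𝓡 3).prod 𝓘(ℝ, ℝ)).tangent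
      (fun q => (⟨q, Z q⟩ : TangentBundle ((𝓡 3).prod 𝓘(ℝ, ℝ)) (G × ℝ))) p) :
    extDerivOne (dtForm G) Y Z p = 0 := by
  have h := mvfderiv_mlieBracket (u := (Prod.snd : G × ℝ → ℝ)) contMDiff_snd.contMDiffAt hY hZ
  exact sub_eq_zero.2 h.symm

/-- The exterior derivative commutes with the pull-back to `G × ℝ`, on lifts of vector fields. -/
theorem extDerivOne_pullFst_liftField {α : OneForm (𝓡 3) (M := G)} (hα : IsLeftInvariantForm α)
    {V V' : VecField (𝓡 3) (M := G)} (hV : SmoothFieldOn V univ) (hV' : SmoothFieldOn V' univ)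
    (c c' : ℝ) (p : G × ℝ) :
    extDerivOne (pullFst α) (liftField V c) (liftField V' c') p = extDerivOne α V V' p.1 := by
  have hs := IsSmoothFormOn.of_contMDiff hα.contMDiff univ
  have hd := fun {W : VecField (𝓡 3) (M := G)} (hW : SmoothFieldOn W univ) =>
    hW.mdifferentiableAt isOpen_univ (mem_univ p.1)
  have hl := fun {W : VecField (𝓡 3) (M := G)} (hW : SmoothFieldOn W univ) c =>
    (smoothFieldOn_liftField hW c univ).mdifferentiableAt isOpen_univ (mem_univ p)
  have hrel : ∀ (W : VecField (𝓡 3) (M := G)) (c : ℝ) (q : G × ℝ),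
      mfderiv ((𝓡 3).prod 𝓘(ℝ, ℝ)) (𝓡 3) (Prod.fst : G × ℝ → G) q (liftField W c q) = W q.1 := by
    intro W c q
    rw [mfderiv_fst]
    rfl
  have hb := mfderiv_mlieBracket_of_related (f := (Prod.fst : G × ℝ → G)) (p := p) contMDiff_fst
    (hl hV c) (hl hV' c') (hd hV) (hd hV') (hrel V c) (hrel V' c')
  have hder : ∀ {W W' : VecField (𝓡 3) (M := G)}, SmoothFieldOn W' univ → ∀ c c' : ℝ,
      dirDeriv (liftField W c) (fun q => pullFst α q (liftField W' c' q)) p =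
        dirDeriv W (fun g => α g (W' g)) p.1 := by
    intro W W' hW' c c'
    have h1 : (fun q : G × ℝ => pullFst α q (liftField W' c' q)) =
        fun q => (fun g => α g (W' g)) q.1 := by
      funext q
      rw [pullFst_apply]
      rfl
    rw [h1, dirDeriv, dirDeriv,
      mvfderiv_comp_vector (hs.mdifferentiableAt W' p.1 (mem_univ _) (hd hW'))
        mdifferentiableAt_fst, hrel W c p]
  rw [extDerivOne, extDerivOne, hder hV', hder hV, ← hb]
  rfl

/-- A structure equation `dα = c β ∧ γ` on `G` pulls back to `G × ℝ`. -/
theorem extDerivOne_pullFst {e : Fin 3 → OneForm (𝓡 3) (M := G)}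
    (he : ∀ i, IsLeftInvariantForm (e i)) (hi : ∀ g, LinearIndependent ℝ (fun i => e i g))
    {i j k : Fin 3} {c : ℝ}
    (hs : ∀ X Y : VecField (𝓡 3) (M := G), SmoothFieldOn X univ → SmoothFieldOn Y univ →
      ∀ g, extDerivOne (e i) X Y g = c * wedge (e j) (e k) g (X g) (Y g))
    {p : G × ℝ} {Y Z : VecField ((𝓡 3).prod 𝓘(ℝ, ℝ)) (M := G × ℝ)}
    (hY : MDifferentiableAt ((𝓡 3).prod 𝓘(ℝ, ℝ)) ((𝓡 3).prod 𝓘(ℝ, ℝ)).tangent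
      (fun q => (⟨q, Y q⟩ : TangentBundle ((𝓡 3).prod 𝓘(ℝ, ℝ)) (G × ℝ))) p)
    (hZ : MDifferentiableAt ((𝓡 3).prod 𝓘(ℝ, ℝ)) ((𝓡 3).prod 𝓘(ℝ, ℝ)).tangent
      (fun q => (⟨q, Z q⟩ : TangentBundle ((𝓡 3).prod 𝓘(ℝ, ℝ)) (G × ℝ))) p) :
    extDerivOne (pullFst (e i)) Y Z p =
      c * wedge (pullFst (e j)) (pullFst (e k)) p (Y p) (Z p) := by
  obtain ⟨V, hV, -, hexp⟩ := exists_dual_frame he hi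
  -- Every tangent vector of `G × ℝ` is the value of a lift, and `d` is tensorial.
  have hext : ∀ v : TangentSpace ((𝓡 3).prod 𝓘(ℝ, ℝ)) p, ∃ (W : VecField (𝓡 3) (M := G)) (c : ℝ),
      SmoothFieldOn W univ ∧ liftField W c p = v := by
    intro v
    refine ⟨fun g => ∑ l, pullFst (e l) p v • V l g, dtForm G p v, ?_, ?_⟩
    · exact ContMDiffOn.sum_section fun l _ =>
        (contMDiffOn_const (c := pullFst (e l) p v)).smul_section (hV l)
    · refine Prod.ext ?_ (dtForm_apply p v)
      simp only [pullFst_apply]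
      exact (hexp p.1 _).symm
  obtain ⟨W, a, hW, hWY⟩ := hext (Y p)
  obtain ⟨W', a', hW', hWZ⟩ := hext (Z p)
  obtain ⟨B, hB⟩ := (isSmoothFormOn_pullFst (he i) univ).exists_bilin_extDerivOne (mem_univ p)
  have hl := fun {W : VecField (𝓡 3) (M := G)} (hW : SmoothFieldOn W univ) c =>
    (smoothFieldOn_liftField hW c univ).mdifferentiableAt isOpen_univ (mem_univ p)
  rw [hB Y Z hY hZ, ← hWY, ← hWZ, ← hB _ _ (hl hW a) (hl hW' a'),
    extDerivOne_pullFst_liftField (he i) hW hW', hs W W' hW hW', wedge_apply, wedge_apply]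
  simp only [pullFst_apply]
  rfl

end Group

/-! ### Evolved coframes -/

section Evolution

variable {G : Type*} [TopologicalSpace G] [ChartedSpace (EuclideanSpace ℝ (Fin 3)) G] [Group G]
  [LieGroup (𝓡 3) ∞ G] {T : Set ℝ}

omit [Group G] [LieGroup (𝓡 3) ∞ G] in
theorem evolvedForm_apply (u : ℝ → ℝ) (α : OneForm (𝓡 3) (M := G)) (p : G × ℝ)
    (v : TangentSpace ((𝓡 3).prod 𝓘(ℝ, ℝ)) p) :
    evolvedForm u α p v = u p.2 * pullFst α p v := rfl

omit [Group G] [LieGroup (𝓡 3) ∞ G] in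
theorem timeForm_apply (u : ℝ → ℝ) (p : G × ℝ) (v : TangentSpace ((𝓡 3).prod 𝓘(ℝ, ℝ)) p) :
    timeForm G u p v = u p.2 * dtForm G p v := rfl

omit [Group G] [LieGroup (𝓡 3) ∞ G] in
theorem contMDiffOn_comp_snd {u : ℝ → ℝ} (hu : ContDiffOn ℝ ∞ u T) :
    ContMDiffOn ((𝓡 3).prod 𝓘(ℝ, ℝ)) 𝓘(ℝ, ℝ) ∞ (fun p : G × ℝ => u p.2) (univ ×ˢ T) :=
  hu.contMDiffOn.comp contMDiff_snd.contMDiffOn fun _ hp => hp.2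

omit [Group G] [LieGroup (𝓡 3) ∞ G] in
theorem dirDeriv_comp_snd {u : ℝ → ℝ} {p : G × ℝ} (hu : DifferentiableAt ℝ u p.2)
    (Y : VecField ((𝓡 3).prod 𝓘(ℝ, ℝ)) (M := G × ℝ)) :
    dirDeriv Y (fun q : G × ℝ => u q.2) p = deriv u p.2 * dtForm G p (Y p) := by
  rw [dirDeriv, mvfderiv_comp_vector (I' := 𝓘(ℝ, ℝ)) hu.mdifferentiableAt mdifferentiableAt_snd]
  simp only [mvfderiv, mfderiv_eq_fderiv]
  refine (fderiv_eq_smul_deriv (f := u) _).trans ?_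
  exact mul_comm (dtForm G p (Y p)) (deriv u p.2)

theorem vec4_apply_two {α : Type*} {β : α → Type*} (x₀ x₁ x₂ x₃ : (a : α) → β a) (a : α) :
    ![x₀, x₁, x₂, x₃] 2 a = x₂ a := rfl

theorem vec4_apply_three {α : Type*} {β : α → Type*} (x₀ x₁ x₂ x₃ : (a : α) → β a) (a : α) :
    ![x₀, x₁, x₂, x₃] 3 a = x₃ a := rfl

/-- The coframe `f₁ e¹, f₂ e², f₃ e³, f dt`. -/
def evolvedCoframe (e : Fin 3 → OneForm (𝓡 3) (M := G)) (f f₁ f₂ f₃ : ℝ → ℝ) :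
    Fin 4 → OneForm ((𝓡 3).prod 𝓘(ℝ, ℝ)) (M := G × ℝ) :=
  ![evolvedForm f₁ (e 0), evolvedForm f₂ (e 1), evolvedForm f₃ (e 2), timeForm G f]

/-- With `b₁, b₂, b₃` the structure constants of the coframe on `G`, the evolved coframe has the
coefficients `Aᵢ = fᵢ' / (f fᵢ)` and `Bᵢ = bᵢ fᵢ / (fⱼ f_k)`. -/
theorem IsBianchiCoframe.exists_isDiagonalCoframeOn {τ : BianchiType}
    {e : Fin 3 → OneForm (𝓡 3) (M := G)} (he : IsBianchiCoframe τ e) (hT : IsOpen T)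
    {f f₁ f₂ f₃ : ℝ → ℝ} (hf : IsEvolutionData T f f₁ f₂ f₃) :
    ∃ X, IsDiagonalCoframeOn (evolvedCoframe e f f₁ f₂ f₃) X
      (![fun p => deriv f₁ p.2 / (f p.2 * f₁ p.2), fun p => deriv f₂ p.2 / (f p.2 * f₂ p.2),
        fun p => deriv f₃ p.2 / (f p.2 * f₃ p.2)] : Fin 3 → G × ℝ → ℝ)
      (![fun p => τ.structureConst 0 * f₁ p.2 / (f₂ p.2 * f₃ p.2),
        fun p => τ.structureConst 1 * f₂ p.2 / (f₃ p.2 * f₁ p.2),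
        fun p => τ.structureConst 2 * f₃ p.2 / (f₁ p.2 * f₂ p.2)] : Fin 3 → G × ℝ → ℝ)
      (univ ×ˢ T) := by
  have hU : IsOpen ((univ : Set G) ×ˢ T) := isOpen_univ.prod hT
  obtain ⟨V, hV, hdual, hexp⟩ := exists_dual_frame he.left_invariant he.independent
  have hdiff : ∀ {u : ℝ → ℝ}, ContDiffOn ℝ ∞ u T → ∀ p ∈ (univ : Set G) ×ˢ T,
      DifferentiableAt ℝ u p.2 := fun hu p hp =>
    (hu.contDiffAt (hT.mem_nhds hp.2)).differentiableAt (by simp)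
  have hinv : ∀ {u : ℝ → ℝ}, ContDiffOn ℝ ∞ u T → (∀ t ∈ T, u t ≠ 0) →
      ContMDiffOn ((𝓡 3).prod 𝓘(ℝ, ℝ)) 𝓘(ℝ, ℝ) ∞ (fun p : G × ℝ => (u p.2)⁻¹) (univ ×ˢ T) :=
    fun hu hu0 => contMDiffOn_comp_snd (hu.inv hu0)
  have hsm : ∀ {u : ℝ → ℝ}, ContDiffOn ℝ ∞ u T → ∀ p ∈ (univ : Set G) ×ˢ T,
      MDifferentiableAt ((𝓡 3).prod 𝓘(ℝ, ℝ)) 𝓘(ℝ, ℝ) (fun p : G × ℝ => u p.2) p := fun hu p hp =>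
    ((contMDiffOn_comp_snd hu).contMDiffAt (hU.mem_nhds hp)).mdifferentiableAt (by simp)
  have hform : ∀ {u : ℝ → ℝ}, ContDiffOn ℝ ∞ u T → ∀ i,
      IsSmoothFormOn (evolvedForm u (e i)) (univ ×ˢ T) := fun hu i =>
    (isSmoothFormOn_pullFst (he.left_invariant i) _).smul hU (contMDiffOn_comp_snd hu)
  -- The exterior derivative of `u(t) eⁱ`.
  have hd : ∀ {u : ℝ → ℝ}, ContDiffOn ℝ ∞ u T → (∀ t ∈ T, u t ≠ 0) → ∀ {i j k : Fin 3} {c : ℝ},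
      (∀ X Y : VecField (𝓡 3) (M := G), SmoothFieldOn X univ → SmoothFieldOn Y univ →
        ∀ g, extDerivOne (e i) X Y g = c * wedge (e j) (e k) g (X g) (Y g)) →
      ∀ p ∈ (univ : Set G) ×ˢ T, ∀ Y Z : VecField ((𝓡 3).prod 𝓘(ℝ, ℝ)) (M := G × ℝ),
      MDifferentiableAt ((𝓡 3).prod 𝓘(ℝ, ℝ)) ((𝓡 3).prod 𝓘(ℝ, ℝ)).tangent
        (fun q => (⟨q, Y q⟩ : TangentBundle ((𝓡 3).prod 𝓘(ℝ, ℝ)) (G × ℝ))) p →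
      MDifferentiableAt ((𝓡 3).prod 𝓘(ℝ, ℝ)) ((𝓡 3).prod 𝓘(ℝ, ℝ)).tangent
        (fun q => (⟨q, Z q⟩ : TangentBundle ((𝓡 3).prod 𝓘(ℝ, ℝ)) (G × ℝ))) p →
      extDerivOne (evolvedForm u (e i)) Y Z p =
        deriv u p.2 / (f p.2 * u p.2) *
            wedge (timeForm G f) (evolvedForm u (e i)) p (Y p) (Z p)
          + u p.2 * (c * wedge (pullFst (e j)) (pullFst (e k)) p (Y p) (Z p)) := by
    intro u hu hu0 i j k c hs p hp Y Z hY hZ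
    have hθ := isSmoothFormOn_pullFst (he.left_invariant i) (univ ×ˢ T)
    refine (extDerivOne_smul (hsm hu p hp) (hθ.mdifferentiableAt Y p hp hY)
      (hθ.mdifferentiableAt Z p hp hZ)).trans ?_
    rw [dirDeriv_comp_snd (hdiff hu p hp), dirDeriv_comp_snd (hdiff hu p hp),
      extDerivOne_pullFst he.left_invariant he.independent hs hY hZ]
    simp only [wedge_apply, evolvedForm_apply, timeForm_apply]
    have h0 := hf.ne_zero p.2 hp.2
    have h1 := hu0 p.2 hp.2
    field_simp
  have hpf : ∀ (i : Fin 3) (W : VecField (𝓡 3) (M := G)) (c : ℝ) (p : G × ℝ),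
      pullFst (e i) p (liftField W c p) = e i p.1 (W p.1) := fun i W c p => pullFst_apply _ _ _
  have hdt : ∀ (W : VecField (𝓡 3) (M := G)) (c : ℝ) (p : G × ℝ),
      dtForm G p (liftField W c p) = c := fun W c p => dtForm_apply _ _
  have h0s : SmoothFieldOn (0 : VecField (𝓡 3) (M := G)) univ :=
    (Bundle.contMDiff_zeroSection ℝ (TangentSpace (𝓡 3) : G → Type _)).contMDiffOn
  refine ⟨![fun p => (f₁ p.2)⁻¹ • liftField (V 0) 0 p, fun p => (f₂ p.2)⁻¹ • liftField (V 1) 0 p,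
    fun p => (f₃ p.2)⁻¹ • liftField (V 2) 0 p, fun p => (f p.2)⁻¹ • liftField 0 1 p],
    hU, ?_, ?_, ?_, ?_, ?_, ?_, ?_, ?_⟩
  · intro a
    fin_cases a
    · exact hform hf.smooth₁ 0
    · exact hform hf.smooth₂ 1
    · exact hform hf.smooth₃ 2
    · exact (isSmoothFormOn_dtForm _).smul hU (contMDiffOn_comp_snd hf.smooth)
  · intro a
    fin_cases a
    · exact (hinv hf.smooth₁ hf.ne_zero₁).smul_section (smoothFieldOn_liftField (hV 0) 0 _)
    · exact (hinv hf.smooth₂ hf.ne_zero₂).smul_section (smoothFieldOn_liftField (hV 1) 0 _)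
    · exact (hinv hf.smooth₃ hf.ne_zero₃).smul_section (smoothFieldOn_liftField (hV 2) 0 _)
    · exact (hinv hf.smooth hf.ne_zero).smul_section (smoothFieldOn_liftField h0s 1 _)
  · intro p hp a b
    have h0 := hf.ne_zero p.2 hp.2
    have h1 := hf.ne_zero₁ p.2 hp.2
    have h2 := hf.ne_zero₂ p.2 hp.2
    have h3 := hf.ne_zero₃ p.2 hp.2
    fin_cases a <;> fin_cases b <;>
      simp [-Matrix.cons_val, vec4_apply_two, vec4_apply_three, evolvedCoframe,
        evolvedForm_apply, timeForm_apply, hpf, hdt, hdual, h0, h1, h2, h3]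
  · intro p hp v
    have h0 := hf.ne_zero p.2 hp.2
    have h1 := hf.ne_zero₁ p.2 hp.2
    have h2 := hf.ne_zero₂ p.2 hp.2
    have h3 := hf.ne_zero₃ p.2 hp.2
    have hcancel : ∀ {x : ℝ} (y : ℝ), x ≠ 0 → x * y * x⁻¹ = y := fun y hx => by field_simp
    simp only [Fin.sum_univ_four, evolvedCoframe, Matrix.cons_val, evolvedForm_apply,
      timeForm_apply, smul_smul, hcancel _ h0, hcancel _ h1, hcancel _ h2, hcancel _ h3]
    refine Prod.ext ?_ ?_
    · have := hexp p.1 (show EuclideanSpace ℝ (Fin 3) × ℝ from v).1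
      rw [Fin.sum_univ_three] at this
      simp only [pullFst_apply]
      refine this.trans ?_
      change _ = _ + _ • (0 : EuclideanSpace ℝ (Fin 3))
      rw [smul_zero, add_zero]
      rfl
    · simp only [dtForm_apply]
      change _ = _ * (0 : ℝ) + _ * (0 : ℝ) + _ * (0 : ℝ) + _ * (1 : ℝ)
      simp
  · intro p hp Y Z hY hZ
    refine (hd hf.smooth₁ hf.ne_zero₁ he.structure_eq₁ p hp Y Z hY hZ).trans ?_
    have h2 := hf.ne_zero₂ p.2 hp.2
    have h3 := hf.ne_zero₃ p.2 hp.2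
    simp only [evolvedCoframe, Matrix.cons_val, wedge_apply, evolvedForm_apply]
    field_simp
    ring
  · intro p hp Y Z hY hZ
    refine (hd hf.smooth₂ hf.ne_zero₂ he.structure_eq₂ p hp Y Z hY hZ).trans ?_
    have h1 := hf.ne_zero₁ p.2 hp.2
    have h3 := hf.ne_zero₃ p.2 hp.2
    simp only [evolvedCoframe, Matrix.cons_val, wedge_apply, evolvedForm_apply]
    field_simp
    ring
  · intro p hp Y Z hY hZ
    refine (hd hf.smooth₃ hf.ne_zero₃ he.structure_eq₃ p hp Y Z hY hZ).trans ?_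
    have h1 := hf.ne_zero₁ p.2 hp.2
    have h2 := hf.ne_zero₂ p.2 hp.2
    simp only [evolvedCoframe, Matrix.cons_val, wedge_apply, evolvedForm_apply]
    field_simp
    ring
  · intro p hp Y Z hY hZ
    have hθ := isSmoothFormOn_dtForm (univ ×ˢ T : Set (G × ℝ))
    refine (extDerivOne_smul (α := dtForm G) (hsm hf.smooth p hp) (hθ.mdifferentiableAt Y p hp hY)
      (hθ.mdifferentiableAt Z p hp hZ)).trans ?_
    rw [dirDeriv_comp_snd (hdiff hf.smooth p hp), dirDeriv_comp_snd (hdiff hf.smooth p hp),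
      extDerivOne_dtForm hY hZ]
    ring

/-- The system `(f₁ f₂)' = b₃ f f₃`, `(f₁ f₃)' = b₂ f f₂`, `(f₂ f₃)' = b₁ f f₁`. -/
def GeneralSystem (b : Fin 3 → ℝ) (T : Set ℝ) (f f₁ f₂ f₃ : ℝ → ℝ) : Prop :=
  ProductDerivs T f₁ f₂ f₃ (fun t => b 2 * (f t * f₃ t)) (fun t => b 1 * (f t * f₂ t))
    (fun t => b 0 * (f t * f₁ t))

/-- The equation `(u v)' = b f w`, divided by `f u v`. -/
theorem hasDerivAt_mul_iff {f u v w : ℝ → ℝ} {t b : ℝ} (hu : DifferentiableAt ℝ u t)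
    (hv : DifferentiableAt ℝ v t) (h0 : f t ≠ 0) (h1 : u t ≠ 0) (h2 : v t ≠ 0) :
    HasDerivAt (fun s => u s * v s) (b * (f t * w t)) t ↔
      deriv u t / (f t * u t) + deriv v t / (f t * v t) = b * w t / (u t * v t) := by
  have h := hu.hasDerivAt.mul hv.hasDerivAt
  have h3 : HasDerivAt (fun s => u s * v s) (b * (f t * w t)) t ↔
      deriv u t * v t + u t * deriv v t = b * (f t * w t) :=
    ⟨fun h' => h.unique h', fun h' => h' ▸ h⟩
  rw [h3]
  field_simp

/-- The hyper-Kähler condition is a system of differential equations with coefficients the structure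
constants of the coframe. -/
theorem isTriaxialHyperKahler_iff {τ : BianchiType} {e : Fin 3 → OneForm (𝓡 3) (M := G)}
    (he : IsBianchiCoframe τ e) (hT : IsOpen T) {f f₁ f₂ f₃ : ℝ → ℝ}
    (hf : IsEvolutionData T f f₁ f₂ f₃) :
    IsTriaxialHyperKahler e T f f₁ f₂ f₃ ↔ GeneralSystem τ.structureConst T f f₁ f₂ f₃ := by
  obtain ⟨X, hX⟩ := he.exists_isDiagonalCoframeOn hT hf
  refine (hX.isHyperKahlerOn_iff).trans ?_
  have hd : ∀ {u : ℝ → ℝ}, ContDiffOn ℝ ∞ u T → ∀ t ∈ T, DifferentiableAt ℝ u t := fun hu t ht =>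
    (hu.contDiffAt (hT.mem_nhds ht)).differentiableAt (by simp)
  have key : ∀ t ∈ T, _ := fun t ht =>
    and_congr (hasDerivAt_mul_iff (b := τ.structureConst 2) (w := f₃) (hd hf.smooth₁ t ht)
      (hd hf.smooth₂ t ht) (hf.ne_zero t ht) (hf.ne_zero₁ t ht) (hf.ne_zero₂ t ht))
    (and_congr (hasDerivAt_mul_iff (b := τ.structureConst 1) (w := f₂) (hd hf.smooth₁ t ht)
      (hd hf.smooth₃ t ht) (hf.ne_zero t ht) (hf.ne_zero₁ t ht) (hf.ne_zero₃ t ht))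
    (hasDerivAt_mul_iff (b := τ.structureConst 0) (w := f₁) (hd hf.smooth₂ t ht)
      (hd hf.smooth₃ t ht) (hf.ne_zero t ht) (hf.ne_zero₂ t ht) (hf.ne_zero₃ t ht)))
  constructor
  · intro h t ht
    have := h (1, t) ⟨mem_univ _, ht⟩
    simp only [Matrix.cons_val, mul_comm (f₃ t) (f₁ t)] at this
    exact (key t ht).2 this
  · intro h p hp
    simp only [Matrix.cons_val, mul_comm (f₃ p.2) (f₁ p.2)]
    exact (key p.2 hp.2).1 (h p.2 hp.2)

/-- The hyper-symplectic condition is the same system, with the sign of the third structure constant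
changed. This sign produces the matching of the Bianchi types. -/
theorem isTriaxialHyperSymplectic_iff {τ : BianchiType} {e : Fin 3 → OneForm (𝓡 3) (M := G)}
    (he : IsBianchiCoframe τ e) (hT : IsOpen T) {f f₁ f₂ f₃ : ℝ → ℝ}
    (hf : IsEvolutionData T f f₁ f₂ f₃) :
    IsTriaxialHyperSymplectic e T f f₁ f₂ f₃ ↔
      GeneralSystem ![τ.structureConst 0, τ.structureConst 1, -τ.structureConst 2]
        T f f₁ f₂ f₃ := by
  obtain ⟨X, hX⟩ := he.exists_isDiagonalCoframeOn hT hf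
  refine (hX.isHyperSymplecticOn_iff).trans ?_
  have hd : ∀ {u : ℝ → ℝ}, ContDiffOn ℝ ∞ u T → ∀ t ∈ T, DifferentiableAt ℝ u t := fun hu t ht =>
    (hu.contDiffAt (hT.mem_nhds ht)).differentiableAt (by simp)
  have key : ∀ t ∈ T, _ := fun t ht =>
    and_congr (hasDerivAt_mul_iff (b := -τ.structureConst 2) (w := f₃) (hd hf.smooth₁ t ht)
      (hd hf.smooth₂ t ht) (hf.ne_zero t ht) (hf.ne_zero₁ t ht) (hf.ne_zero₂ t ht))
    (and_congr (hasDerivAt_mul_iff (b := τ.structureConst 1) (w := f₂) (hd hf.smooth₁ t ht)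
      (hd hf.smooth₃ t ht) (hf.ne_zero t ht) (hf.ne_zero₁ t ht) (hf.ne_zero₃ t ht))
    (hasDerivAt_mul_iff (b := τ.structureConst 0) (w := f₁) (hd hf.smooth₂ t ht)
      (hd hf.smooth₃ t ht) (hf.ne_zero t ht) (hf.ne_zero₂ t ht) (hf.ne_zero₃ t ht)))
  constructor
  · intro h t ht
    have := h (1, t) ⟨mem_univ _, ht⟩
    simp only [Matrix.cons_val, mul_comm (f₃ t) (f₁ t), ← neg_div, ← neg_mul] at this
    exact (key t ht).2 this
  · intro h p hp
    simp only [Matrix.cons_val, mul_comm (f₃ p.2) (f₁ p.2), ← neg_div, ← neg_mul]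
    exact (key p.2 hp.2).1 (h p.2 hp.2)

end Evolution

/-! ### The systems of differential equations -/

theorem evolutionSystem_iff (τ : BianchiType) (T : Set ℝ) (f f₁ f₂ f₃ : ℝ → ℝ) :
    EvolutionSystem τ T f f₁ f₂ f₃ ↔ GeneralSystem τ.structureConst T f f₁ f₂ f₃ := by
  cases τ <;>
    simp [EvolutionSystem, GeneralSystem, BianchiType.structureConst]

theorem evolutionSystem_iff_matching (τ : BianchiType) (T : Set ℝ) (f f₁ f₂ f₃ : ℝ → ℝ) :
    EvolutionSystem τ T f f₁ f₂ f₃ ↔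
      GeneralSystem ![τ.matching.structureConst 0, τ.matching.structureConst 1,
        -τ.matching.structureConst 2] T f f₁ f₂ (fun t => τ.matchingSign * f₃ t) := by
  have hneg : ∀ (u v : ℝ → ℝ) (c t : ℝ), HasDerivAt (fun s => -(u s * v s)) (-c) t ↔
      HasDerivAt (fun s => u s * v s) c t := fun u v c t =>
    ⟨fun h => by simpa using h.fun_neg, fun h => h.fun_neg⟩
  cases τ with
  | II =>
    have hneg0 := fun u v => hneg u v 0
    simp only [neg_zero] at hneg0
    simp [EvolutionSystem, GeneralSystem, ProductDerivs, BianchiType.structureConst,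
      BianchiType.matching, BianchiType.matchingSign, hneg0]
  | _ =>
    simp [EvolutionSystem, GeneralSystem, BianchiType.structureConst, BianchiType.matching,
      BianchiType.matchingSign]

theorem IsEvolutionData.matchingSign {T : Set ℝ} {f f₁ f₂ f₃ : ℝ → ℝ}
    (hf : IsEvolutionData T f f₁ f₂ f₃) (τ : BianchiType) :
    IsEvolutionData T f f₁ f₂ (fun t => τ.matchingSign * f₃ t) :=
  { hf with
    smooth₃ := contDiffOn_const.mul hf.smooth₃
    ne_zero₃ := fun t ht => mul_ne_zero (by cases τ <;> simp [BianchiType.matchingSign])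
      (hf.ne_zero₃ t ht) }

/-! ### Explicit solutions -/

section Solutions

variable {T : Set ℝ} {f f₁ f₂ f₃ : ℝ → ℝ}

theorem exists_sign_of_ne_zero (hT : T.OrdConnected) {u : ℝ → ℝ} (hu : ContinuousOn u T)
    (h0 : ∀ t ∈ T, u t ≠ 0) : ∃ ε : ℝ, (ε = 1 ∨ ε = -1) ∧ ∀ t ∈ T, u t = ε * |u t| := by
  rcases hT.isPreconnected.eq_or_eq_neg_of_sq_eq hu hu.abs (fun t _ => (sq_abs (u t)).symm)
    (fun ht => abs_ne_zero.2 (h0 _ ht)) with h | h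
  · exact ⟨1, Or.inl rfl, fun t ht => by simpa using h ht⟩
  · exact ⟨-1, Or.inr rfl, fun t ht => by simpa using h ht⟩

theorem exists_eq_const_of_hasDerivAt_zero (hT : IsOpen T) (hT' : T.OrdConnected) {u : ℝ → ℝ}
    (hu : ∀ t ∈ T, HasDerivAt u 0 t) : ∃ c, ∀ t ∈ T, u t = c := by
  obtain ⟨c, hc⟩ := hT.exists_is_const_of_deriv_eq_zero hT'.isPreconnected
    (fun t ht => (hu t ht).differentiableAt.differentiableWithinAt) (fun t ht => (hu t ht).deriv)
  exact ⟨c, hc⟩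

theorem pow_four_rpow_quarter {x : ℝ} (hx : 0 ≤ x) : (x ^ 4) ^ (1 / 4 : ℝ) = x := by
  simpa using Real.pow_rpow_inv_natCast hx (n := 4) (by simp)

theorem rpow_quarter_pow_four {x : ℝ} (hx : 0 ≤ x) : (x ^ (1 / 4 : ℝ)) ^ 4 = x := by
  simpa using Real.rpow_inv_natCast_pow hx (n := 4) (by simp)

theorem sqrt_eq_rpow_quarter_sq {x : ℝ} (hx : 0 ≤ x) : √x = (x ^ (1 / 4 : ℝ)) ^ 2 := by
  rw [Real.sqrt_eq_iff_mul_self_eq hx (by positivity), ← pow_add, rpow_quarter_pow_four hx]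

/-- With `yᵢ = (uⱼ u_k)²`, the fourth roots of the `yᵢ` determine the `uᵢ`. -/
theorem eq_quarter_mul_quarter_div {u₁ u₂ u₃ : ℝ} (h₁ : 0 < u₁) (h₂ : 0 < u₂) (h₃ : 0 < u₃) :
    ((u₁ * u₃) ^ 2) ^ (1 / 4 : ℝ) * ((u₁ * u₂) ^ 2) ^ (1 / 4 : ℝ) /
      ((u₂ * u₃) ^ 2) ^ (1 / 4 : ℝ) = u₁ := by
  have hs : ∀ {u : ℝ}, 0 < u → ∃ s, 0 < s ∧ u = s ^ 2 := fun {u} hu =>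
    ⟨√u, Real.sqrt_pos.2 hu, (Real.sq_sqrt hu.le).symm⟩
  obtain ⟨s₁, p₁, rfl⟩ := hs h₁
  obtain ⟨s₂, p₂, rfl⟩ := hs h₂
  obtain ⟨s₃, p₃, rfl⟩ := hs h₃
  have h4 : ∀ {s t : ℝ}, 0 < s → 0 < t → ((s ^ 2 * t ^ 2) ^ 2) ^ (1 / 4 : ℝ) = s * t :=
    fun {s t} p q => by
      rw [show (s ^ 2 * t ^ 2) ^ 2 = (s * t) ^ 4 by ring]
      exact pow_four_rpow_quarter (mul_pos p q).le
  rw [h4 p₁ p₃, h4 p₁ p₂, h4 p₂ p₃]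
  field_simp

/-- The squares `yᵢ = (fⱼ f_k)²` have derivatives proportional to `f f₁ f₂ f₃`, with constant
factors `2 bᵢ`. Hence they are affine functions `bᵢ x + cᵢ` of any `x` among them with `bᵢ = 1`. -/
theorem GeneralSystem.exists_quarticForm {b : Fin 3 → ℝ} (hT : IsOpen T) (hT' : T.OrdConnected)
    (hb : ∃ i, b i = 1) (hf : IsEvolutionData T f f₁ f₂ f₃)
    (h : GeneralSystem b T f f₁ f₂ f₃) :
    ∃ ε₁ ε₂ ε₃ : ℝ, (ε₁ = 1 ∨ ε₁ = -1) ∧ (ε₂ = 1 ∨ ε₂ = -1) ∧ (ε₃ = 1 ∨ ε₃ = -1) ∧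
      ∃ (c : Fin 3 → ℝ) (x : ℝ → ℝ), QuarticForm T ε₁ ε₂ ε₃ x (fun t => b 0 * x t + c 0)
        (fun t => b 1 * x t + c 1) (fun t => b 2 * x t + c 2) f f₁ f₂ f₃ := by
  obtain ⟨ε₁, s₁, e₁⟩ := exists_sign_of_ne_zero hT' hf.smooth₁.continuousOn hf.ne_zero₁
  obtain ⟨ε₂, s₂, e₂⟩ := exists_sign_of_ne_zero hT' hf.smooth₂.continuousOn hf.ne_zero₂
  obtain ⟨ε₃, s₃, e₃⟩ := exists_sign_of_ne_zero hT' hf.smooth₃.continuousOn hf.ne_zero₃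
  let y : Fin 3 → ℝ → ℝ := ![fun t => (f₂ t * f₃ t) ^ 2, fun t => (f₁ t * f₃ t) ^ 2,
    fun t => (f₁ t * f₂ t) ^ 2]
  have hy : ∀ i, ∀ t ∈ T, HasDerivAt (y i) (b i * (2 * (f t * f₁ t * f₂ t * f₃ t))) t := by
    intro i t ht
    obtain ⟨h12, h13, h23⟩ := h t ht
    fin_cases i
    · exact (h23.fun_pow 2).congr_deriv (by push_cast; ring)
    · exact (h13.fun_pow 2).congr_deriv (by push_cast; ring)
    · exact (h12.fun_pow 2).congr_deriv (by push_cast; ring)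
  have hys : ∀ i, ContDiffOn ℝ ∞ (y i) T := by
    intro i
    fin_cases i
    · exact (hf.smooth₂.mul hf.smooth₃).pow 2
    · exact (hf.smooth₁.mul hf.smooth₃).pow 2
    · exact (hf.smooth₁.mul hf.smooth₂).pow 2
  obtain ⟨k, hk⟩ := hb
  have hc : ∀ i, ∃ c, ∀ t ∈ T, y i t - b i * y k t = c := fun i =>
    exists_eq_const_of_hasDerivAt_zero hT hT' fun t ht =>
      ((hy i t ht).sub ((hy k t ht).const_mul (b i))).congr_deriv (by rw [hk]; ring)
  choose c hc using hc
  refine ⟨ε₁, ε₂, ε₃, s₁, s₂, s₃, c, y k, hys k, fun t ht => ?_⟩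
  have hyc : ∀ i, b i * y k t + c i = y i t := fun i => by rw [← hc i t ht]; ring
  have hder : deriv (y k) t = 2 * (f t * f₁ t * f₂ t * f₃ t) := by
    rw [(hy k t ht).deriv, hk, one_mul]
  have n := hf.ne_zero t ht
  have n₁ := hf.ne_zero₁ t ht
  have n₂ := hf.ne_zero₂ t ht
  have n₃ := hf.ne_zero₃ t ht
  have p₁ := abs_pos.2 n₁
  have p₂ := abs_pos.2 n₂
  have p₃ := abs_pos.2 n₃
  have hy0 : y 0 t = (|f₂ t| * |f₃ t|) ^ 2 := by rw [← abs_mul, sq_abs]; rfl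
  have hy1 : y 1 t = (|f₁ t| * |f₃ t|) ^ 2 := by rw [← abs_mul, sq_abs]; rfl
  have hy2 : y 2 t = (|f₁ t| * |f₂ t|) ^ 2 := by rw [← abs_mul, sq_abs]; rfl
  simp only [hyc, hder, hy0, hy1, hy2]
  refine ⟨by simp [n, n₁, n₂, n₃], by positivity, by positivity, by positivity, ?_, ?_, ?_, ?_⟩
  · rw [eq_quarter_mul_quarter_div p₁ p₂ p₃]
    exact e₁ t ht
  · rw [mul_comm |f₁ t| |f₂ t|, eq_quarter_mul_quarter_div p₂ p₁ p₃]
    exact e₂ t ht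
  · rw [mul_comm |f₁ t| |f₃ t|, mul_comm |f₂ t| |f₃ t|, eq_quarter_mul_quarter_div p₃ p₁ p₂]
    exact e₃ t ht
  · rw [show (|f₂ t| * |f₃ t|) ^ 2 * (|f₁ t| * |f₃ t|) ^ 2 * (|f₁ t| * |f₂ t|) ^ 2 =
        (|f₁ t| * |f₂ t| * |f₃ t|) ^ 4 by ring, Real.rpow_neg (by positivity),
      pow_four_rpow_quarter (by positivity)]
    have hprod : ε₁ * ε₂ * ε₃ * (f₁ t * f₂ t * f₃ t) = |f₁ t| * |f₂ t| * |f₃ t| := by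
      have q : ∀ {ε : ℝ}, (ε = 1 ∨ ε = -1) → ε * ε = 1 := by
        rintro _ (rfl | rfl) <;> norm_num
      calc ε₁ * ε₂ * ε₃ * (f₁ t * f₂ t * f₃ t)
          = ε₁ * ε₂ * ε₃ * ((ε₁ * |f₁ t|) * (ε₂ * |f₂ t|) * (ε₃ * |f₃ t|)) := by
            rw [← e₁ t ht, ← e₂ t ht, ← e₃ t ht]
        _ = (ε₁ * ε₁) * (ε₂ * ε₂) * (ε₃ * ε₃) * (|f₁ t| * |f₂ t| * |f₃ t|) := by ring
        _ = _ := by rw [q s₁, q s₂, q s₃]; ring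
    calc f t = (|f₁ t| * |f₂ t| * |f₃ t|)⁻¹ * (|f₁ t| * |f₂ t| * |f₃ t|) * f t := by
          rw [inv_mul_cancel₀ (by positivity), one_mul]
      _ = (|f₁ t| * |f₂ t| * |f₃ t|)⁻¹ * (ε₁ * ε₂ * ε₃ * (f₁ t * f₂ t * f₃ t)) * f t := by
          rw [hprod]
      _ = _ := by ring

/-- Since `fᵢ fⱼ = εᵢ εⱼ √y_k`, the affine functions `yᵢ = bᵢ x + cᵢ` of `x` give solutions of the
system with the coefficients `bᵢ`. -/
theorem QuarticForm.isEvolutionData_and_generalSystem {b c : Fin 3 → ℝ} {x : ℝ → ℝ}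
    {ε₁ ε₂ ε₃ : ℝ} (hT : IsOpen T) (s₁ : ε₁ = 1 ∨ ε₁ = -1) (s₂ : ε₂ = 1 ∨ ε₂ = -1)
    (s₃ : ε₃ = 1 ∨ ε₃ = -1) (h : QuarticForm T ε₁ ε₂ ε₃ x (fun t => b 0 * x t + c 0)
      (fun t => b 1 * x t + c 1) (fun t => b 2 * x t + c 2) f f₁ f₂ f₃) :
    IsEvolutionData T f f₁ f₂ f₃ ∧ GeneralSystem b T f f₁ f₂ f₃ := by
  obtain ⟨hx, h⟩ := h
  have q0 : ∀ {ε : ℝ}, (ε = 1 ∨ ε = -1) → ε ≠ 0 := by rintro _ (rfl | rfl) <;> norm_num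
  let y : Fin 3 → ℝ → ℝ := fun i t => b i * x t + c i
  have hpos : ∀ i, ∀ t ∈ T, 0 < y i t := fun i t ht => by
    obtain ⟨-, p₀, p₁, p₂, -⟩ := h t ht
    fin_cases i
    exacts [p₀, p₁, p₂]
  have hys : ∀ i, ContDiffOn ℝ ∞ (y i) T := fun i =>
    (contDiffOn_const.mul hx).add contDiffOn_const
  have hyr : ∀ i, ContDiffOn ℝ ∞ (fun t => y i t ^ (1 / 4 : ℝ)) T := fun i =>
    (hys i).rpow_const_of_ne fun t ht => (hpos i t ht).ne'
  have hyd : ∀ i, ∀ t ∈ T, HasDerivAt (fun s => √(y i s))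
      (b i * deriv x t / (2 * (y i t ^ (1 / 4 : ℝ)) ^ 2)) t := by
    intro i t ht
    have hxd := ((hx.contDiffAt (hT.mem_nhds ht)).differentiableAt (by simp)).hasDerivAt
    have := ((hxd.const_mul (b i)).add_const (c i)).sqrt (hpos i t ht).ne'
    rw [← sqrt_eq_rpow_quarter_sq (hpos i t ht).le]
    exact this
  have hf : ∀ t ∈ T, f t = ε₁ * ε₂ * ε₃ * (1 / 2 * (y 0 t ^ (1 / 4 : ℝ) * y 1 t ^ (1 / 4 : ℝ) *
      y 2 t ^ (1 / 4 : ℝ))⁻¹ * deriv x t) := by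
    intro t ht
    have p₀ := (hpos 0 t ht).le
    have p₁ := (hpos 1 t ht).le
    have p₂ := (hpos 2 t ht).le
    rw [← Real.mul_rpow p₀ p₁, ← Real.mul_rpow (mul_nonneg p₀ p₁) p₂,
      ← Real.rpow_neg (mul_nonneg (mul_nonneg p₀ p₁) p₂)]
    exact (h t ht).2.2.2.2.2.2.2
  have hf₁ : ∀ t ∈ T, f₁ t = ε₁ * (y 1 t ^ (1 / 4 : ℝ) * y 2 t ^ (1 / 4 : ℝ) /
      y 0 t ^ (1 / 4 : ℝ)) := fun t ht => (h t ht).2.2.2.2.1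
  have hf₂ : ∀ t ∈ T, f₂ t = ε₂ * (y 0 t ^ (1 / 4 : ℝ) * y 2 t ^ (1 / 4 : ℝ) /
      y 1 t ^ (1 / 4 : ℝ)) := fun t ht => (h t ht).2.2.2.2.2.1
  have hf₃ : ∀ t ∈ T, f₃ t = ε₃ * (y 0 t ^ (1 / 4 : ℝ) * y 1 t ^ (1 / 4 : ℝ) /
      y 2 t ^ (1 / 4 : ℝ)) := fun t ht => (h t ht).2.2.2.2.2.2.1
  have hne : ∀ i, ∀ t ∈ T, y i t ^ (1 / 4 : ℝ) ≠ 0 := fun i t ht =>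
    (Real.rpow_pos_of_pos (hpos i t ht) _).ne'
  have hdx : ContDiffOn ℝ ∞ (deriv x) T := hx.deriv_of_isOpen hT (by simp)
  have hx0 : ∀ t ∈ T, deriv x t ≠ 0 := fun t ht => (h t ht).1
  clear_value y
  refine ⟨⟨?_, ?_, ?_, ?_, ?_, ?_, ?_, ?_⟩, ?_⟩
  · exact (contDiffOn_const.mul ((contDiffOn_const.mul ((((hyr 0).mul (hyr 1)).mul (hyr 2)).inv
      fun t ht => mul_ne_zero (mul_ne_zero (hne 0 t ht) (hne 1 t ht)) (hne 2 t ht))).mul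
      hdx)).congr hf
  · exact (contDiffOn_const.mul (((hyr 1).mul (hyr 2)).div (hyr 0) (hne 0))).congr hf₁
  · exact (contDiffOn_const.mul (((hyr 0).mul (hyr 2)).div (hyr 1) (hne 1))).congr hf₂
  · exact (contDiffOn_const.mul (((hyr 0).mul (hyr 1)).div (hyr 2) (hne 2))).congr hf₃
  · intro t ht
    rw [hf t ht]
    exact mul_ne_zero (mul_ne_zero (mul_ne_zero (q0 s₁) (q0 s₂)) (q0 s₃)) (mul_ne_zero
      (mul_ne_zero (by norm_num) (inv_ne_zero (mul_ne_zero (mul_ne_zero (hne 0 t ht) (hne 1 t ht))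
        (hne 2 t ht)))) (hx0 t ht))
  · intro t ht
    rw [hf₁ t ht]
    exact mul_ne_zero (q0 s₁) (div_ne_zero (mul_ne_zero (hne 1 t ht) (hne 2 t ht)) (hne 0 t ht))
  · intro t ht
    rw [hf₂ t ht]
    exact mul_ne_zero (q0 s₂) (div_ne_zero (mul_ne_zero (hne 0 t ht) (hne 2 t ht)) (hne 1 t ht))
  · intro t ht
    rw [hf₃ t ht]
    exact mul_ne_zero (q0 s₃) (div_ne_zero (mul_ne_zero (hne 0 t ht) (hne 1 t ht)) (hne 2 t ht))
  · intro t ht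
    have n₀ := hne 0 t ht
    have n₁ := hne 1 t ht
    have n₂ := hne 2 t ht
    -- The product `fᵢ fⱼ` is `εᵢ εⱼ √y_k` near `t`.
    have key : ∀ (u v : ℝ → ℝ) (ε : ℝ) (i : Fin 3) (d : ℝ),
        (∀ s ∈ T, u s * v s = ε * (y i s ^ (1 / 4 : ℝ)) ^ 2) →
        ε * (b i * deriv x t / (2 * (y i t ^ (1 / 4 : ℝ)) ^ 2)) = d →
        HasDerivAt (fun s => u s * v s) d t := by
      intro u v ε i d huv hd
      refine (((hyd i t ht).const_mul ε).congr_of_eventuallyEq ?_).congr_deriv hd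
      filter_upwards [hT.mem_nhds ht] with s hs
      rw [huv s hs, sqrt_eq_rpow_quarter_sq (hpos i s hs).le]
    refine ⟨key f₁ f₂ (ε₁ * ε₂) 2 _ (fun s hs => ?_) ?_,
      key f₁ f₃ (ε₁ * ε₃) 1 _ (fun s hs => ?_) ?_, key f₂ f₃ (ε₂ * ε₃) 0 _ (fun s hs => ?_) ?_⟩
    · have := hne 0 s hs
      have := hne 1 s hs
      rw [hf₁ s hs, hf₂ s hs]
      field_simp
    · simp only [hf t ht, hf₃ t ht]
      rcases s₃ with rfl | rfl <;> field_simp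
    · have := hne 0 s hs
      have := hne 2 s hs
      rw [hf₁ s hs, hf₃ s hs]
      field_simp
    · simp only [hf t ht, hf₂ t ht]
      rcases s₂ with rfl | rfl <;> field_simp
    · have := hne 1 s hs
      have := hne 2 s hs
      rw [hf₂ s hs, hf₃ s hs]
      field_simp
    · simp only [hf t ht, hf₁ t ht]
      rcases s₁ with rfl | rfl <;> field_simp

/-- The explicit solutions of type II are those of the common form with `y₁ = a` and `y₂ = b`
constant and `y₃ = x + c`, up to the substitution `w = y₃^{3/4}`. -/
theorem explicitForm_II_iff (hT : IsOpen T) (ε₁ ε₂ ε₃ : ℝ) :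
    ExplicitForm .II T ε₁ ε₂ ε₃ f f₁ f₂ f₃ ↔ ∃ (c : Fin 3 → ℝ) (x : ℝ → ℝ),
      QuarticForm T ε₁ ε₂ ε₃ x (fun _ => c 0) (fun _ => c 1) (fun t => x t + c 2) f f₁ f₂ f₃ := by
  constructor
  · rintro ⟨a, b, c, r, ha, hb, hr, h⟩
    set k : ℝ := (a * b) ^ (1 / 4 : ℝ) with hk
    have hk0 : 0 < k := Real.rpow_pos_of_pos (mul_pos ha hb) _
    let w : ℝ → ℝ := fun t => 3 / 2 * k * r t + c
    have hw : ∀ t ∈ T, 0 < w t := fun t ht => (h t ht).2.1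
    have hws : ContDiffOn ℝ ∞ w T := (contDiffOn_const.mul hr).add contDiffOn_const
    refine ⟨![a, b, 0], fun t => w t ^ (4 / 3 : ℝ),
      hws.rpow_const_of_ne fun t ht => (hw t ht).ne', fun t ht => ?_⟩
    obtain ⟨hr0, -, h1, h2, h3, h4⟩ := h t ht
    have hp := Real.rpow_pos_of_pos (hw t ht) (1 / 3)
    have hy := Real.rpow_pos_of_pos (hw t ht) (4 / 3)
    have hrd := ((hr.contDiffAt (hT.mem_nhds ht)).differentiableAt (by simp)).hasDerivAt
    have hd : deriv (fun t => w t ^ (4 / 3 : ℝ)) t = 2 * k * w t ^ (1 / 3 : ℝ) * deriv r t := by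
      have h5 := (((hrd.const_mul (3 / 2 * k)).add_const c).rpow_const (p := 4 / 3)
        (Or.inl (hw t ht).ne')).deriv
      refine h5.trans ?_
      rw [show (4 / 3 - 1 : ℝ) = 1 / 3 by norm_num]
      change _ * w t ^ (1 / 3 : ℝ) = _
      ring
    have hq : (w t ^ (4 / 3 : ℝ)) ^ (1 / 4 : ℝ) = w t ^ (1 / 3 : ℝ) := by
      rw [← Real.rpow_mul (hw t ht).le]
      norm_num
    have hkab : k = a ^ (1 / 4 : ℝ) * b ^ (1 / 4 : ℝ) := Real.mul_rpow ha.le hb.le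
    have ha4 := Real.rpow_pos_of_pos ha (1 / 4)
    have hb4 := Real.rpow_pos_of_pos hb (1 / 4)
    rw [hd]
    simp only [Matrix.cons_val, add_zero, hq]
    refine ⟨by positivity, ha, hb, Real.rpow_pos_of_pos (hw t ht) _, ?_, ?_, ?_, ?_⟩
    · rw [h1, Real.div_rpow hb.le ha.le]
      change _ * (_ * w t ^ (1 / 3 : ℝ)) = _
      ring
    · rw [h2, Real.div_rpow ha.le hb.le]
      change _ * (_ * w t ^ (1 / 3 : ℝ)) = _
      ring
    · rw [h3, ← hkab]
    · rw [h4, Real.rpow_neg (mul_pos (mul_pos ha hb) hy).le,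
        Real.mul_rpow (mul_pos ha hb).le hy.le, ← hk,
        hq]
      field_simp
  · rintro ⟨c, x, hx, h⟩
    rcases T.eq_empty_or_nonempty with rfl | ⟨t₀, ht₀⟩
    · exact ⟨1, 1, 0, 0, one_pos, one_pos, contDiffOn_const, fun t ht => ht.elim⟩
    obtain ⟨-, ha, hb, -⟩ := h t₀ ht₀
    have hab := mul_pos ha hb
    set k : ℝ := (c 0 * c 1) ^ (1 / 4 : ℝ) with hk
    have hk0 : 0 < k := Real.rpow_pos_of_pos hab _
    have hkab : k = c 0 ^ (1 / 4 : ℝ) * c 1 ^ (1 / 4 : ℝ) := Real.mul_rpow ha.le hb.le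
    have ha4 := Real.rpow_pos_of_pos ha (1 / 4)
    have hb4 := Real.rpow_pos_of_pos hb (1 / 4)
    let y : ℝ → ℝ := fun t => x t + c 2
    have hy : ∀ t ∈ T, 0 < y t := fun t ht => (h t ht).2.2.2.1
    have hys : ContDiffOn ℝ ∞ y T := hx.add contDiffOn_const
    refine ⟨c 0, c 1, 0, fun t => 2 / 3 * k⁻¹ * y t ^ (3 / 4 : ℝ), ha, hb,
      contDiffOn_const.mul (hys.rpow_const_of_ne fun t ht => (hy t ht).ne'), fun t ht => ?_⟩
    obtain ⟨hx0, -, -, -, h1, h2, h3, h4⟩ := h t ht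
    have hp := Real.rpow_pos_of_pos (hy t ht) (1 / 4)
    have hxd := ((hx.contDiffAt (hT.mem_nhds ht)).differentiableAt (by simp)).hasDerivAt
    have hd : deriv (fun t => 2 / 3 * k⁻¹ * y t ^ (3 / 4 : ℝ)) t =
        1 / 2 * (k * y t ^ (1 / 4 : ℝ))⁻¹ * deriv x t := by
      have h5 := (((hxd.add_const (c 2)).rpow_const (p := 3 / 4)
        (Or.inl (hy t ht).ne')).const_mul (2 / 3 * k⁻¹)).deriv
      refine h5.trans ?_
      rw [show (3 / 4 - 1 : ℝ) = -(1 / 4) by norm_num, mul_inv,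
        ← Real.rpow_neg (hy t ht).le]
      change _ * (_ * y t ^ (-(1 / 4) : ℝ)) = _
      ring
    have hw : 3 / 2 * k * (2 / 3 * k⁻¹ * y t ^ (3 / 4 : ℝ)) + 0 = y t ^ (3 / 4 : ℝ) := by
      field_simp
      ring
    have hq : (y t ^ (3 / 4 : ℝ)) ^ (1 / 3 : ℝ) = y t ^ (1 / 4 : ℝ) := by
      rw [← Real.rpow_mul (hy t ht).le]
      norm_num
    simp only [hd, hw, hq, ← hk]
    refine ⟨by positivity, Real.rpow_pos_of_pos (hy t ht) _, ?_, ?_, ?_, ?_⟩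
    · rw [h1, Real.div_rpow hb.le ha.le]
      change _ * (_ * y t ^ (1 / 4 : ℝ) / _) = _
      ring
    · rw [h2, Real.div_rpow ha.le hb.le]
      change _ * (_ * y t ^ (1 / 4 : ℝ) / _) = _
      ring
    · rw [h3, hkab]
    · rw [h4, Real.rpow_neg (mul_pos hab (hy t ht)).le, Real.mul_rpow hab.le (hy t ht).le]

/-- In all types the explicit solutions are those with `yᵢ = bᵢ x + cᵢ`. -/
theorem explicitForm_iff (hT : IsOpen T) (τ : BianchiType) (ε₁ ε₂ ε₃ : ℝ) :
    ExplicitForm τ T ε₁ ε₂ ε₃ f f₁ f₂ f₃ ↔ ∃ (c : Fin 3 → ℝ) (x : ℝ → ℝ),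
      QuarticForm T ε₁ ε₂ ε₃ x (fun t => τ.structureConst 0 * x t + c 0)
        (fun t => τ.structureConst 1 * x t + c 1) (fun t => τ.structureConst 2 * x t + c 2)
        f f₁ f₂ f₃ := by
  have hexists : ∀ {P : ℝ → ℝ → ℝ → (ℝ → ℝ) → Prop} (σ : Fin 3 → ℝ), (∀ i, σ i * σ i = 1) →
      ((∃ (a₁ a₂ a₃ : ℝ) (x : ℝ → ℝ), P a₁ a₂ a₃ x) ↔
        ∃ (c : Fin 3 → ℝ) (x : ℝ → ℝ), P (σ 0 * c 0) (σ 1 * c 1) (σ 2 * c 2) x) := by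
    intro P σ hσ
    constructor
    · rintro ⟨a₁, a₂, a₃, x, h⟩
      refine ⟨![σ 0 * a₁, σ 1 * a₂, σ 2 * a₃], x, ?_⟩
      simpa [← mul_assoc, hσ] using h
    · rintro ⟨c, x, h⟩
      exact ⟨_, _, _, x, h⟩
  cases τ with
  | IX =>
    refine (hexists ![-1, -1, -1] (by simp [Fin.forall_fin_succ])).trans ?_
    simp [BianchiType.structureConst]
  | VIII =>
    refine (hexists ![-1, -1, 1] (by simp [Fin.forall_fin_succ])).trans ?_
    simp [BianchiType.structureConst, sub_eq_neg_add, add_comm]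
  | VII0 =>
    refine (hexists ![1, -1, -1] (by simp [Fin.forall_fin_succ])).trans ?_
    simp [BianchiType.structureConst]
  | VI0 =>
    refine (hexists ![1, -1, 1] (by simp [Fin.forall_fin_succ])).trans ?_
    simp [BianchiType.structureConst, sub_eq_neg_add, add_comm]
  | II =>
    refine (explicitForm_II_iff hT ε₁ ε₂ ε₃).trans ?_
    simp [BianchiType.structureConst]

/-- The general solution of the system of each Bianchi type. -/
theorem isEvolutionData_and_evolutionSystem_iff (τ : BianchiType) (hT : IsOpen T)
    (hT' : T.OrdConnected) :
    (IsEvolutionData T f f₁ f₂ f₃ ∧ EvolutionSystem τ T f f₁ f₂ f₃) ↔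
      ∃ ε₁ ε₂ ε₃ : ℝ, (ε₁ = 1 ∨ ε₁ = -1) ∧ (ε₂ = 1 ∨ ε₂ = -1) ∧ (ε₃ = 1 ∨ ε₃ = -1) ∧
        ExplicitForm τ T ε₁ ε₂ ε₃ f f₁ f₂ f₃ := by
  simp only [evolutionSystem_iff, explicitForm_iff hT]
  constructor
  · rintro ⟨hf, h⟩
    refine h.exists_quarticForm hT hT' ?_ hf
    cases τ
    case II => exact ⟨2, rfl⟩
    all_goals exact ⟨1, rfl⟩
  · rintro ⟨ε₁, ε₂, ε₃, s₁, s₂, s₃, c, x, h⟩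
    exact h.isEvolutionData_and_generalSystem hT s₁ s₂ s₃

end Solutions

end

/-! ### Bianchi types, structures and solutions -/

theorem mainTheorem5 (τ : BianchiType) (T : Set ℝ) (hT : IsOpen T) (hT' : T.OrdConnected) :
    (∀ f f₁ f₂ f₃ : ℝ → ℝ, IsEvolutionData T f f₁ f₂ f₃ →
      (∀ (G : Type u) [TopologicalSpace G] [ChartedSpace (EuclideanSpace ℝ (Fin 3)) G] [Group G]
        [LieGroup (𝓡 3) ∞ G] (e : Fin 3 → OneForm (𝓡 3) (M := G)), IsBianchiCoframe τ e →
        (IsTriaxialHyperKahler e T f f₁ f₂ f₃ ↔ EvolutionSystem τ T f f₁ f₂ f₃)) ∧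
      (∀ (G : Type u) [TopologicalSpace G] [ChartedSpace (EuclideanSpace ℝ (Fin 3)) G] [Group G]
        [LieGroup (𝓡 3) ∞ G] (e : Fin 3 → OneForm (𝓡 3) (M := G)),
        IsBianchiCoframe τ.matching e →
        (IsTriaxialHyperSymplectic e T f f₁ f₂ (fun t => τ.matchingSign * f₃ t) ↔
          EvolutionSystem τ T f f₁ f₂ f₃))) ∧
    (∀ f f₁ f₂ f₃ : ℝ → ℝ,
      (IsEvolutionData T f f₁ f₂ f₃ ∧ EvolutionSystem τ T f f₁ f₂ f₃) ↔
        ∃ ε₁ ε₂ ε₃ : ℝ, (ε₁ = 1 ∨ ε₁ = -1) ∧ (ε₂ = 1 ∨ ε₂ = -1) ∧ (ε₃ = 1 ∨ ε₃ = -1) ∧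
          ExplicitForm τ T ε₁ ε₂ ε₃ f f₁ f₂ f₃) := by

  refine ⟨fun f f₁ f₂ f₃ hf => ⟨fun G _ _ _ _ e he => ?_, fun G _ _ _ _ e he => ?_⟩,
    fun f f₁ f₂ f₃ => isEvolutionData_and_evolutionSystem_iff τ hT hT'⟩
  · rw [evolutionSystem_iff]
    exact isTriaxialHyperKahler_iff he hT hf
  · rw [evolutionSystem_iff_matching]
    exact isTriaxialHyperSymplectic_iff he hT (hf.matchingSign τ)
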